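/- Let $\Gamma=(\Gamma_j)_{j\in J}$ be a family of lattices $\Gamma_j=c_j\mathbb Z\subset\mathbb R$, $c_j>0$, with covolume $\operatorname{covol}(\Gamma_j)=c_j$ and dual lattice $\Gamma_j^\perp=\{\alpha\in\mathbb R: e^{2\pi i\alpha\gamma}=1\ \text{for all}\ \gamma\in\Gamma_j\}=c_j^{-1}\mathbb Z$, and let $E\subset\mathbb R$ be a closed set of Lebesgue measure zero. Write $T_xf=f(\cdot-x)$, let $\hat f(\omega)=\int f(x)e^{-2\pi i x\omega}\,dx$ be the Fourier transform (extended to $L^2(\mathbb R)$), and let $\mathcal D_E$ be the set of all $f\in L^2(\mathbb R)$ such that $\hat f\in L^\infty(\mathbb R)$ and $\hat f$ vanishes a.e. outside some compact set $K\subset\mathbb R\setminus E$. A family $(g_j)_{j\in J}$ in $L^2(\mathbb R)$ is called a system of frame generators if $(T_\gamma g_j)_{j\in J,\gamma\in\Gamma_j}$ is a frame of $L^2(\mathbb R)$, that is, if there are $0<A\le B<\infty$ with $A\|f\|^2\le\sum_{j\in J}\sum_{\gamma\in\Gamma_j}|\langle f,T_\gamma g_j\rangle|^2\le B\|f\|^2$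 for all $f\in L^2(\mathbb R)$. Such a family satisfies * the LIC if for all $f\in\mathcal D_E$ $$\sum_{j\in J}\sum_{\alpha\in\Gamma_j^\perp}\frac1{\operatorname{covol}(\Gamma_j)}\int_{\mathbb R}|\hat f(\omega)\hat f(\omega+\alpha)|\,|\hat g_j(\omega)|^2\,d\omega<\infty;$$ * the $\alpha$-LIC if for all $f\in\mathcal D_E$ $$\sum_{j\in J}\sum_{\alpha\in\Gamma_j^\perp}\frac1{\operatorname{covol}(\Gamma_j)}\int_{\mathbb R}|\hat f(\omega)\hat g_j(\omega)\hat f(\omega+\alpha)\hat g_j(\omega+\alpha)|\,d\omega<\infty;$$ * the $1$-UCP if for all $f\in\mathcal D_E$, with $w_j(x)=\sum_{\gamma\in\Gamma_j}|\langle T_xf,T_\gamma g_j\rangle|^2$, the pointwise sum $w(x)=\sum_{j\in J}w_j(x)$ is finite for every $x\in\mathbb R$ and defines an almost periodic function (a bounded continuous function whose set of translates is relatively compact in the uniform norm), and for every $\varepsilon>0$ there is a finite set $J'\subset J$ such that for all finite $J''$ with $J'\subset J''\subset J$ $$M\Bigl(\bigl|w-\sum_{j\in J''}w_j\bigr|\Bigr)<\varepsilon,\qquad\text{where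 } M(F)=\lim_{n\to\infty}\frac1{2n}\int_{-n}^nF(x)\,dx.$$ Then the following are equivalent: 1. there exists a system $(g_j)_{j\in J}$ of frame generators satisfying the LIC; 2. there exists a system $(g_j)_{j\in J}$ of frame generators satisfying the $\alpha$-LIC; 3. there exists a system $(g_j)_{j\in J}$ of frame generators satisfying the $1$-UCP; 4. the system bandwidth $\sum_{j\in J}1/\operatorname{covol}(\Gamma_j)$ is infinite. -/

import Mathlib

open MeasureTheory Filter Topology BoundedContinuousFunction
open scoped FourierTransform ENNReal

noncomputable section

namespace GSI

/-- The Hilbert space `L²(ℝ)` of complex-valued functions. -/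
abbrev L2 : Type := Lp ℂ 2 (volume : Measure ℝ)

/-- The translation operator `T_x f = f(· - x)` on `L²(ℝ)`. -/
def translate (x : ℝ) (f : L2) : L2 :=
  Lp.compMeasurePreserving (fun y : ℝ => y - x) (measurePreserving_sub_right volume x) f

/-- A family `η` in a Hilbert space is a frame if, for some constants `A > 0` and `B`,
`A ‖f‖² ≤ ∑ i, |⟨f, η i⟩|² ≤ B ‖f‖²` for all `f` (the series being convergent). -/
def IsFrame {ι H : Type*} [NormedAddCommGroup H] [InnerProductSpace ℂ H] (η : ι → H) : Prop :=
  ∃ A B : ℝ, 0 < A ∧ ∀ f : H,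
    Summable (fun i => ‖inner ℂ (η i) f‖ ^ 2) ∧
    A * ‖f‖ ^ 2 ≤ ∑' i, ‖inner ℂ (η i) f‖ ^ 2 ∧
    ∑' i, ‖inner ℂ (η i) f‖ ^ 2 ≤ B * ‖f‖ ^ 2

/-- The annihilator `Γ^⊥` of a lattice `Γ` in `ℝ`: the frequencies `α` whose character
`x ↦ e^{2π i x α}` is trivial on `Γ`. (The dual group of `ℝ` is identified with `ℝ`.) -/
def annihilator (Γ : Submodule ℤ ℝ) : Set ℝ :=
  {α | ∀ γ ∈ Γ, Real.fourierChar (γ * α) = 1}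

/-- The space `𝓓_E` of all `f ∈ L²(ℝ)` with Fourier transform in `L^∞` and vanishing a.e. outside
some compact set that is disjoint from the blind spot `E`. -/
def testSpace (E : Set ℝ) : Set L2 :=
  {f | MemLp (𝓕 f : L2) ∞ volume ∧
    ∃ K : Set ℝ, IsCompact K ∧ K ⊆ Eᶜ ∧ K.indicator (𝓕 f : L2) =ᵐ[volume] (𝓕 f : L2)}

/-- Almost periodic functions on `ℝ` (Bochner): the set of translates is relatively compact in
the uniform norm. -/
def IsAlmostPeriodic (w : ℝ →ᵇ ℂ) : Prop :=
  IsCompact (closure (Set.range fun x : ℝ =>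
    w.compContinuous ⟨fun y : ℝ => y - x, continuous_id.sub continuous_const⟩))

/-- `F` has mean `m`: the averages of `F` over the intervals `(-n, n)` converge to `m`. -/
def HasMean (F : ℝ → ℝ) (m : ℝ) : Prop :=
  Tendsto (fun n : ℕ => (1 / (2 * (n : ℝ))) * ∫ x in (-(n : ℝ))..(n : ℝ), F x) atTop (𝓝 m)

/-- The function `w_{f;g,h,j}(x) = ∑_{γ ∈ Γ} ⟨T_x f, T_γ g⟩ ⟨T_γ h, T_x f⟩`, for `Γ = Γ_j`,
`g = g_j`, `h = h_j`. Mathlib's inner product is conjugate-linear in its first argument. -/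
def wTerm (Γ : Submodule ℤ ℝ) (f g h : L2) (x : ℝ) : ℂ :=
  ∑' γ : Γ, inner ℂ (translate (γ : ℝ) g) (translate x f) *
    inner ℂ (translate x f) (translate (γ : ℝ) h)

variable {J : Type*}

/-- The generalized shift-invariant system `(T_γ g_j)_{j ∈ J, γ ∈ Γ_j}`. -/
def system (Γ : J → Submodule ℤ ℝ) (g : J → L2) (p : Σ j, Γ j) : L2 :=
  translate (p.2 : ℝ) (g p.1)

/-- `(g_j)` is a system of frame generators for the lattices `(Γ_j)`. -/
def IsFrameGenerators (Γ : J → Submodule ℤ ℝ) (g : J → L2) : Prop :=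
  IsFrame (system Γ g)

/-- The dual `1`-unconditional convergence property with respect to the blind spot `E`: for each
`f ∈ 𝓓_E`, the pointwise sum `w = w_{f;g,h}` of the functions `w_{f;g,h,j}` exists and is almost
periodic, and the series converges to `w` unconditionally with respect to the mean of `|·|`. -/
def DualOneUCP (E : Set ℝ) (Γ : J → Submodule ℤ ℝ) (g h : J → L2) : Prop :=
  ∀ f ∈ testSpace E, ∃ w : ℝ →ᵇ ℂ,
    (∀ x, HasSum (fun j => wTerm (Γ j) f (g j) (h j) x) (w x)) ∧
    IsAlmostPeriodic w ∧
    ∀ ε : ℝ, 0 < ε → ∃ J' : Finset J, ∀ J'' : Finset J, J' ⊆ J'' →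
      ∃ m : ℝ, m < ε ∧
        HasMean (fun x => ‖w x - ∑ j ∈ J'', wTerm (Γ j) f (g j) (h j) x‖) m

/-- The `1`-unconditional convergence property (`1`-UCP) of a single system. -/
def OneUCP (E : Set ℝ) (Γ : J → Submodule ℤ ℝ) (g : J → L2) : Prop :=
  DualOneUCP E Γ g g

/-- The local integrability condition (LIC): for every `f ∈ 𝓓_E`,
`∑_j ∑_{α ∈ Γ_j^⊥} covol(Γ_j)⁻¹ ∫ |f̂(ω) f̂(ω + α)| |ĝ_j(ω)|² dω < ∞`. -/
def LIC (E : Set ℝ) (Γ : J → Submodule ℤ ℝ) (g : J → L2) : Prop :=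
  ∀ f ∈ testSpace E,
    ∑' (j : J) (α : annihilator (Γ j)),
      ENNReal.ofReal (1 / ZLattice.covolume (Γ j)) *
        ∫⁻ ω : ℝ, ‖(𝓕 f : L2) ω * (𝓕 f : L2) (ω + (α : ℝ))‖ₑ * ‖(𝓕 (g j) : L2) ω‖ₑ ^ 2 < ∞

/-- The `α`-local integrability condition (`α`-LIC): for every `f ∈ 𝓓_E`,
`∑_j ∑_{α ∈ Γ_j^⊥} covol(Γ_j)⁻¹ ∫ |f̂(ω) ĝ_j(ω) f̂(ω + α) ĝ_j(ω + α)| dω < ∞`. -/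
def AlphaLIC (E : Set ℝ) (Γ : J → Submodule ℤ ℝ) (g : J → L2) : Prop :=
  ∀ f ∈ testSpace E,
    ∑' (j : J) (α : annihilator (Γ j)),
      ENNReal.ofReal (1 / ZLattice.covolume (Γ j)) *
        ∫⁻ ω : ℝ, ‖(𝓕 f : L2) ω * (𝓕 (g j) : L2) ω *
          (𝓕 f : L2) (ω + (α : ℝ)) * (𝓕 (g j) : L2) (ω + (α : ℝ))‖ₑ < ∞

/-- The bandwidth `∑_j 1 / covol(Γ_j) ∈ [0, ∞]` of a family of lattices. -/
def bandwidth (Γ : J → Submodule ℤ ℝ) : ℝ≥0∞ :=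
  ∑' j, ENNReal.ofReal (1 / ZLattice.covolume (Γ j))

end GSI

end

/-!
A system of frame generators forces infinite bandwidth by an averaging argument. For a test
function `f` put `w_j(x) = ∑_{γ ∈ Γ_j} |⟨T_x f, T_γ g_j⟩|²` (`energy`). Since
`x ↦ ⟨T_x f, T_γ g_j⟩` is a translate of the Fourier integral of `f̂ · conj ĝ_j`
(`inner_translate`), Plancherel's identity shows that `w_j` has integral
`∫ |f̂|² |ĝ_j|²` over each period of `Γ_j`. For `f̂ = 1_K` the mean of `w_j` is therefore at most
`‖g_j‖² / covol(Γ_j) ≤ B / covol(Γ_j)`, where `B` is the upper frame bound, while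
`∑_j w_j(x) ≥ A vol(K)` for every `x`. As soon as all but finitely many of the `w_j` together
have mean at most `1`, it follows that `A vol(K) ≤ 1 + B ∑_j 1 / covol(Γ_j)`, and `vol(K)` can be
arbitrarily large because `E` is a closed null set (`bandwidth_eq_top_of_remainder`). The `1`-UCP
provides the smallness of the remainder by definition. The `α`-LIC provides it uniformly in `x`:
by Parseval's identity for the periodization of `f̂ · conj ĝ_j`, the function `w_j` is bounded by
the `j`-th term of the `α`-LIC (`tsum_enorm_sq_fourier_le`). The LIC implies the `α`-LIC by the
arithmetic-geometric mean inequality (`LIC.alphaLIC`).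

Conversely, if the bandwidth is infinite, the line has a locally finite tiling by intervals `I_j`
of length at most `1 / covol(Γ_j)` (`exists_tiling_real`). With
`ĝ_j = covol(Γ_j)^{1/2} 1_{I_j}`, Parseval's identity makes each `w_j` constant, equal to
`∫_{I_j} |f̂|²` (`energy_bandpass`). These constants add up to `‖f‖²`, which gives a Parseval frame
with the `1`-UCP, and local finiteness gives the LIC (`lic_bandpass`).
-/

namespace GSI

open Set

variable {J : Type*}

/-! ### Decomposing integrals over the translates of a period -/

lemma lintegral_eq_tsum_Ioc {T : ℝ} (hT : 0 < T) (a : ℝ) (φ : ℝ → ℝ≥0∞) :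
    ∫⁻ x, φ x = ∑' n : ℤ, ∫⁻ x in Ioc a (a + T), φ (x + n * T) := by
  rw [← setLIntegral_univ, ← iUnion_Ioc_add_zsmul hT a,
    lintegral_iUnion (fun _ => measurableSet_Ioc) (pairwise_disjoint_Ioc_add_zsmul a T)]
  refine tsum_congr fun n => ?_
  rw [← (measurePreserving_add_right volume ((n : ℝ) * T)).setLIntegral_comp_preimage_emb
    (measurableEmbedding_addRight _), preimage_add_const_Ioc]
  congr 3
  · simp
  · simp; ring

lemma hasSum_integral_Ioc {T : ℝ} (hT : 0 < T) (a : ℝ) {φ : ℝ → ℂ} (hφ : Integrable φ) :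
    HasSum (fun n : ℤ => ∫ x in Ioc a (a + T), φ (x + n * T)) (∫ x, φ x) := by
  have h := hasSum_integral_iUnion (μ := volume) (f := φ)
    (s := fun n : ℤ => Ioc (a + n • T) (a + (n + 1) • T)) (fun _ => measurableSet_Ioc)
    (pairwise_disjoint_Ioc_add_zsmul a T) hφ.integrableOn
  rw [iUnion_Ioc_add_zsmul hT a, setIntegral_univ] at h
  refine (iff_of_eq (congrArg (HasSum · _) (funext fun n => ?_))).2 h
  symm
  rw [← (measurePreserving_add_right volume ((n : ℝ) * T)).setIntegral_preimage_emb
    (measurableEmbedding_addRight _), preimage_add_const_Ioc]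
  congr 3
  · simp
  · simp; ring

/-! ### Lattices in the real line -/

/-- A lattice in `ℝ` is `cℤ`, where `c > 0` is its covolume. -/
lemma exists_generator (Γ : Submodule ℤ ℝ) [DiscreteTopology Γ] [IsZLattice ℝ Γ] :
    ∃ c : ℝ, 0 < c ∧ ZLattice.covolume Γ = c ∧ ∀ x, x ∈ Γ ↔ ∃ k : ℤ, x = k * c := by
  have : Module.Free ℤ Γ := ZLattice.module_free ℝ Γ
  have : Module.Finite ℤ Γ := ZLattice.module_finite ℝ Γ
  have hr : Module.finrank ℤ Γ = 1 := by rw [ZLattice.rank ℝ Γ]; simp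
  let b := Module.basisUnique Unit hr
  have hcov := ZLattice.covolume_eq_det_mul_measureReal Γ (μ := volume) b
    (Module.Basis.singleton Unit ℝ)
  have hvol : volume.real (ZSpan.fundamentalDomain (Module.Basis.singleton Unit ℝ)) = 1 := by
    have : ZSpan.fundamentalDomain (Module.Basis.singleton Unit ℝ) = Ico 0 1 := by
      ext x
      simp [ZSpan.mem_fundamentalDomain]
    rw [this]; simp
  rw [hvol, mul_one, Module.Basis.det_apply] at hcov
  simp only [Matrix.det_unique, Module.Basis.toMatrix_apply, Function.comp_apply,
    Module.Basis.singleton_repr] at hcov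
  have hne := ZLattice.covolume_pos Γ (μ := volume)
  refine ⟨_, hne, rfl, fun x => ?_⟩
  have key : x ∈ Γ ↔ ∃ k : ℤ, x = k * (b default : ℝ) := by
    constructor
    · intro hx
      refine ⟨b.repr ⟨x, hx⟩ default, ?_⟩
      have := b.sum_repr ⟨x, hx⟩
      simp only [Finset.univ_unique, Finset.sum_singleton] at this
      have := congrArg (Subtype.val) this
      simpa using this.symm
    · rintro ⟨k, rfl⟩
      simpa using Γ.smul_mem k (b default).2
  rw [key, hcov]
  rcases abs_choice (b default : ℝ) with h | h
  · rw [h]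
  · rw [h]
    constructor
    · rintro ⟨k, rfl⟩; exact ⟨-k, by push_cast; ring⟩
    · rintro ⟨k, rfl⟩; exact ⟨-k, by push_cast; ring⟩

lemma fourierChar_eq_one_iff (x : ℝ) : Real.fourierChar x = 1 ↔ ∃ n : ℤ, x = n := by
  have hpi : (2 * Real.pi) ≠ 0 := by positivity
  change Circle.exp (2 * Real.pi * x) = 1 ↔ _
  rw [← Circle.exp_zero, Circle.exp_eq_exp]
  refine exists_congr fun n => ⟨fun h => ?_, fun h => by rw [h]; ring⟩
  have : 2 * Real.pi * x = 2 * Real.pi * n := by linarith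
  exact mul_left_cancel₀ hpi this

/-- The annihilator of `cℤ` is `c⁻¹ℤ`. -/
lemma mem_annihilator_iff {Γ : Submodule ℤ ℝ} {c : ℝ} (hc : 0 < c)
    (h : ∀ x, x ∈ Γ ↔ ∃ k : ℤ, x = k * c) (α : ℝ) :
    α ∈ annihilator Γ ↔ ∃ k : ℤ, α = k * c⁻¹ := by
  constructor
  · intro hα
    obtain ⟨n, hn⟩ := (fourierChar_eq_one_iff _).1 (hα c ((h c).2 ⟨1, by simp⟩))
    exact ⟨n, by rw [← hn]; field_simp⟩
  · rintro ⟨k, rfl⟩ γ hγ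
    obtain ⟨m, rfl⟩ := (h γ).1 hγ
    exact (fourierChar_eq_one_iff _).2 ⟨m * k, by push_cast; field_simp⟩

/-- The enumeration `k ↦ k * c` of a set consisting of the integer multiples of `c ≠ 0`. -/
noncomputable def intMulEquiv {S : Set ℝ} {c : ℝ} (hc : c ≠ 0)
    (h : ∀ x, x ∈ S ↔ ∃ k : ℤ, x = k * c) : ℤ ≃ S :=
  Equiv.ofBijective (fun k => ⟨k * c, (h _).2 ⟨k, rfl⟩⟩)
    ⟨fun a b hab => by
      have := congrArg Subtype.val hab
      simpa [hc] using this,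
    fun x => by
      obtain ⟨k, hk⟩ := (h x).1 x.2
      exact ⟨k, Subtype.ext hk.symm⟩⟩

@[simp] lemma coe_intMulEquiv {S : Set ℝ} {c : ℝ} (hc : c ≠ 0)
    (h : ∀ x, x ∈ S ↔ ∃ k : ℤ, x = k * c) (k : ℤ) :
    ((intMulEquiv hc h k : S) : ℝ) = k * c := rfl

/-! ### Translations on the Fourier side -/

lemma memLp_fourierChar_mul (x : ℝ) (g : L2) :
    MemLp (fun ω : ℝ => (Real.fourierChar (-(x * ω)) : ℂ) * g ω) 2 volume := by
  refine (Lp.memLp g).of_le_mul (c := 1) ?_ (.of_forall fun ω => by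
    rw [norm_mul, Circle.norm_coe])
  exact (Continuous.aestronglyMeasurable (by fun_prop)).mul (Lp.aestronglyMeasurable g)

/-- Multiplication by the character `ω ↦ e^{-2π i x ω}` on `L²(ℝ)`. -/
noncomputable def modulate (x : ℝ) (g : L2) : L2 := (memLp_fourierChar_mul x g).toLp

lemma modulate_ae (x : ℝ) (g : L2) :
    modulate x g =ᵐ[volume] fun ω => (Real.fourierChar (-(x * ω)) : ℂ) * g ω :=
  MemLp.coeFn_toLp _

lemma isometry_modulate (x : ℝ) : Isometry (modulate x) := by
  intro f g
  rw [Lp.edist_def, Lp.edist_def]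
  refine eLpNorm_congr_norm_ae ?_
  filter_upwards [modulate_ae x f, modulate_ae x g] with ω hf hg
  rw [Pi.sub_apply, Pi.sub_apply, hf, hg, ← mul_sub, norm_mul, Circle.norm_coe, one_mul]

lemma translate_ae (x : ℝ) (f : L2) : translate x f =ᵐ[volume] fun y => f (y - x) :=
  Lp.coeFn_compMeasurePreserving _ _

lemma isometry_translate (x : ℝ) : Isometry (translate x) :=
  Lp.isometry_compMeasurePreserving _

lemma norm_translate (x : ℝ) (f : L2) : ‖translate x f‖ = ‖f‖ :=
  Lp.norm_compMeasurePreserving _ _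

/-- The Fourier transform intertwines translation and modulation; both sides are continuous, so it
suffices to check Schwartz functions, where the transform is an integral. -/
lemma fourier_translate (x : ℝ) (f : L2) :
    (𝓕 (translate x f) : L2) = modulate x (𝓕 f) := by
  refine DenseRange.induction_on (p := fun f : L2 => (𝓕 (translate x f) : L2) = modulate x (𝓕 f))
    (SchwartzMap.denseRange_toLpCLM (E := ℝ) (F := ℂ) (p := 2) (μ := volume) ENNReal.ofNat_ne_top)
    f ?_ ?_
  · exact isClosed_eq
      ((Lp.fourierTransformₗᵢ ℝ ℂ).continuous.comp (isometry_translate x).continuous)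
      ((isometry_modulate x).continuous.comp (Lp.fourierTransformₗᵢ ℝ ℂ).continuous)
  · intro φ
    have h1 : translate x (φ.toLp 2 volume) = (φ.compSubConstCLM ℂ x).toLp 2 volume := by
      apply Lp.ext
      refine (translate_ae x _).trans ?_
      have hx := measurePreserving_sub_right (volume : Measure ℝ) x
      have h := hx.quasiMeasurePreserving.ae_eq_comp (φ.coeFn_toLp 2 volume)
      filter_upwards [h, (φ.compSubConstCLM ℂ x).coeFn_toLp 2 volume] with y hy hy'
      rw [hy', SchwartzMap.compSubConstCLM_apply]
      exact hy
    change (𝓕 (translate x (φ.toLp 2 volume)) : L2) = modulate x (𝓕 (φ.toLp 2 volume))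
    rw [h1, SchwartzMap.toLp_fourier_eq, SchwartzMap.toLp_fourier_eq]
    apply Lp.ext
    filter_upwards [modulate_ae x ((𝓕 φ).toLp 2 volume), (𝓕 φ).coeFn_toLp 2 volume,
      (𝓕 (φ.compSubConstCLM ℂ x)).coeFn_toLp 2 volume] with ω h2 h3 h4
    rw [h2, h3, h4, SchwartzMap.fourier_coe, SchwartzMap.fourier_coe]
    have h5 := congrFun (Fourier.fourierIntegral_comp_add_right Real.fourierChar volume φ (-x)) ω
    simp only [Fourier.fourierIntegral_def] at h5
    rw [Real.fourier_real_eq, Real.fourier_real_eq]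
    have h6 : ⇑(φ.compSubConstCLM ℂ x) = ⇑φ ∘ fun v => v + -x := by
      ext v; simp [SchwartzMap.compSubConstCLM_apply, sub_eq_add_neg]
    rw [h6, h5, neg_mul]
    rfl

/-- The pointwise product `f̂ · conj ĝ`, whose Fourier integral is the cross-correlation
`x ↦ ⟨T_x f, g⟩`. -/
noncomputable def crossSpectrum (f g : L2) (ω : ℝ) : ℂ := inner ℂ ((𝓕 g : L2) ω) ((𝓕 f : L2) ω)

lemma integrable_crossSpectrum (f g : L2) : Integrable (crossSpectrum f g) :=
  L2.integrable_inner _ _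

lemma enorm_crossSpectrum (f g : L2) (ω : ℝ) :
    ‖crossSpectrum f g ω‖ₑ = ‖(𝓕 f : L2) ω‖ₑ * ‖(𝓕 g : L2) ω‖ₑ := by
  simp [crossSpectrum, RCLike.inner_apply, enorm_mul]

lemma inner_translate (f g : L2) (x y : ℝ) :
    inner ℂ (translate y g) (translate x f) = 𝓕 (crossSpectrum f g) (x - y) := by
  rw [← Lp.inner_fourier_eq, fourier_translate, fourier_translate, L2.inner_def,
    Real.fourier_real_eq]
  refine integral_congr_ae ?_
  filter_upwards [modulate_ae y (𝓕 g), modulate_ae x (𝓕 f)] with ω hg hf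
  have h : (Real.fourierChar (-(ω * (x - y))) : ℂ)
      = Real.fourierChar (-(x * ω)) * (starRingEnd ℂ) (Real.fourierChar (-(y * ω)) : ℂ) := by
    rw [← Circle.coe_inv_eq_conj, ← AddChar.map_neg_eq_inv, ← Circle.coe_mul,
      ← AddChar.map_add_eq_mul]
    congr 2; ring
  rw [hg, hf, crossSpectrum, Circle.smul_def, smul_eq_mul, h]
  simp only [RCLike.inner_apply, map_mul]
  ring

lemma continuous_fourier_crossSpectrum (f g : L2) : Continuous (𝓕 (crossSpectrum f g)) :=
  VectorFourier.fourierIntegral_continuous Real.continuous_fourierChar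
    (by exact continuous_inner) (integrable_crossSpectrum f g)

/-! ### Parseval and Bessel bounds for samples of a Fourier integral -/

/-- Parseval's identity on a period `(u, u + T]`, without a sign in the exponent. -/
lemma tsum_enorm_sq_integral_Ioc {T : ℝ} (hT : 0 < T) (u : ℝ) {P : ℝ → ℂ}
    (hP : MemLp P 2 (volume.restrict (Ioc u (u + T)))) :
    ∑' k : ℤ, ‖∫ ω in Ioc u (u + T), Real.fourierChar (ω * (k * T⁻¹)) • P ω‖ₑ ^ 2
      = ENNReal.ofReal T * ∫⁻ ω in Ioc u (u + T), ‖P ω‖ₑ ^ 2 := by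
  have hab : u < u + T := by linarith
  have h := hasSum_sq_fourierCoeffOn hab hP
  have hcoeff : ∀ k : ℤ, ‖fourierCoeffOn hab P (-k)‖ ^ 2
      = (T⁻¹) ^ 2 * ‖∫ ω in Ioc u (u + T), Real.fourierChar (ω * (k * T⁻¹)) • P ω‖ ^ 2 := by
    intro k
    rw [fourierCoeffOn_eq_integral, intervalIntegral.integral_of_le hab.le, norm_smul, mul_pow]
    congr 2
    · rw [add_sub_cancel_left, one_div, Real.norm_of_nonneg (by positivity)]
    · congr 1
      refine integral_congr_ae (.of_forall fun ω => ?_)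
      simp only [neg_neg]
      rw [fourier_coe_apply, Circle.smul_def, Real.fourierChar_apply]
      congr 2
      push_cast
      rw [add_sub_cancel_left]
      field_simp
  rw [← (Equiv.neg ℤ).hasSum_iff] at h
  have h' : HasSum (fun k : ℤ =>
      ‖∫ ω in Ioc u (u + T), Real.fourierChar (ω * (k * T⁻¹)) • P ω‖ ^ 2)
      (T * ∫ ω in Ioc u (u + T), ‖P ω‖ ^ 2) := by
    have h2 := h.mul_left (T ^ 2)
    rw [intervalIntegral.integral_of_le hab.le, add_sub_cancel_left, smul_eq_mul] at h2
    have e1 : T * ∫ ω in Ioc u (u + T), ‖P ω‖ ^ 2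
        = T ^ 2 * (T⁻¹ * ∫ ω in Ioc u (u + T), ‖P ω‖ ^ 2) := by
      rw [← mul_assoc, sq, mul_assoc T T, mul_inv_cancel₀ hT.ne', mul_one]
    rw [e1]
    refine (iff_of_eq (congrArg (HasSum · _) (funext fun k => ?_))).2 h2
    rw [Function.comp_apply, Equiv.neg_apply, hcoeff, ← mul_assoc, ← mul_pow,
      mul_inv_cancel₀ hT.ne', one_pow, one_mul]
  have h3 := ENNReal.ofReal_tsum_of_nonneg (fun k => by positivity) h'.summable
  rw [h'.tsum_eq, ENNReal.ofReal_mul hT.le, ofReal_integral_eq_lintegral_ofReal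
    (by simpa using hP.integrable_norm_pow (p := 2) two_ne_zero)
    (.of_forall fun _ => by positivity)] at h3
  simp only [ENNReal.ofReal_pow (norm_nonneg _), ofReal_norm] at h3
  exact h3.symm

lemma fourier_sub_eq_fourier_modulated (F : ℝ → ℂ) (x y : ℝ) :
    𝓕 F (x - y) = ∫ ω, Real.fourierChar (ω * y) • (Real.fourierChar (-(ω * x)) • F ω) := by
  rw [Real.fourier_real_eq]
  refine integral_congr_ae (.of_forall fun ω => ?_)
  simp only [smul_smul]
  rw [← AddChar.map_add_eq_mul]
  congr 2; ring

lemma memLp_fourierChar_smul {F : ℝ → ℂ} {p : ℝ≥0∞} {μ : Measure ℝ} (hF : MemLp F p μ) (x : ℝ) :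
    MemLp (fun ω => Real.fourierChar (-(ω * x)) • F ω) p μ := by
  refine hF.of_le_mul (c := 1) ?_ (.of_forall fun ω => by
    rw [Circle.smul_def, norm_smul, Circle.norm_coe])
  exact (Continuous.aestronglyMeasurable (by fun_prop)).smul hF.1

lemma enorm_fourierChar_smul (t : ℝ) (z : ℂ) : ‖Real.fourierChar t • z‖ₑ = ‖z‖ₑ := by
  rw [← ofReal_norm, Circle.norm_smul, ofReal_norm]

/-- For a function carried by one period, the sampled energies of the Fourier integral on any
coset of the dual lattice add up to the total energy. -/
lemma tsum_enorm_sq_fourier_of_indicator {T : ℝ} (hT : 0 < T) (u : ℝ) {F : ℝ → ℂ}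
    (hF : MemLp F 2 volume) (hs : ∀ᵐ ω, ω ∉ Ioc u (u + T) → F ω = 0) (x : ℝ) :
    ∑' k : ℤ, ‖𝓕 F (x - k * T⁻¹)‖ₑ ^ 2 = ENNReal.ofReal T * ∫⁻ ω, ‖F ω‖ₑ ^ 2 := by
  have h := tsum_enorm_sq_integral_Ioc hT u
    (memLp_fourierChar_smul (hF.restrict (Ioc u (u + T))) x)
  have h2 : ∫⁻ ω, ‖F ω‖ₑ ^ 2 = ∫⁻ ω in Ioc u (u + T), ‖F ω‖ₑ ^ 2 := by
    rw [← lintegral_indicator measurableSet_Ioc]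
    refine lintegral_congr_ae ?_
    filter_upwards [hs] with ω hω
    by_cases hm : ω ∈ Ioc u (u + T)
    · rw [indicator_of_mem hm]
    · rw [indicator_of_notMem hm, hω hm]; simp
  simp only [enorm_fourierChar_smul] at h
  rw [h2, ← h]
  refine tsum_congr fun k => ?_
  rw [fourier_sub_eq_fourier_modulated, setIntegral_eq_integral_of_ae_compl_eq_zero]
  filter_upwards [hs] with ω hω hm
  rw [hω hm, smul_zero, smul_zero]

/-- Plancherel's identity for a square integrable function carried by a bounded interval, by
integrating Parseval's identity over a period of the sampling lattice. -/
lemma lintegral_enorm_sq_fourier {T : ℝ} (hT : 0 < T) (u : ℝ) {F : ℝ → ℂ}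
    (hF : MemLp F 2 volume) (hF1 : Integrable F) (hs : ∀ᵐ ω, ω ∉ Ioc u (u + T) → F ω = 0) :
    ∫⁻ x, ‖𝓕 F x‖ₑ ^ 2 = ∫⁻ ω, ‖F ω‖ₑ ^ 2 := by
  have hcont : Continuous (𝓕 F) := VectorFourier.fourierIntegral_continuous
    Real.continuous_fourierChar (by exact continuous_inner) hF1
  rw [lintegral_eq_tsum_Ioc (inv_pos.2 hT) 0, ← lintegral_tsum
    (fun n => by fun_prop)]
  have : ∀ x, ∑' n : ℤ, ‖𝓕 F (x + n * T⁻¹)‖ₑ ^ 2 = ENNReal.ofReal T * ∫⁻ ω, ‖F ω‖ₑ ^ 2 := by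
    intro x
    rw [← tsum_enorm_sq_fourier_of_indicator hT u hF hs x,
      ← (Equiv.neg ℤ).tsum_eq (fun k : ℤ => ‖𝓕 F (x - k * T⁻¹)‖ₑ ^ 2)]
    refine tsum_congr fun k => ?_
    simp
  simp only [this]
  rw [setLIntegral_const, Real.volume_Ioc, zero_add, sub_zero, mul_right_comm,
    ← ENNReal.ofReal_mul hT.le, mul_inv_cancel₀ hT.ne', ENNReal.ofReal_one, one_mul]

/-- Energy of the `T`-periodization: expanding one factor unfolds the integral over a period. -/
lemma lintegral_periodization_sq {T : ℝ} (hT : 0 < T) {F : ℝ → ℂ} (hF : Measurable F) :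
    ∫⁻ ω in Ioc 0 (0 + T), (∑' n : ℤ, ‖F (ω + n * T)‖ₑ) ^ 2
      = ∑' n : ℤ, ∫⁻ ω, ‖F ω * F (ω + n * T)‖ₑ := by
  have hper : ∀ (ω : ℝ) (m : ℤ), ∑' n : ℤ, ‖F (ω + m * T + n * T)‖ₑ
      = ∑' n : ℤ, ‖F (ω + n * T)‖ₑ := by
    intro ω m
    rw [← (Equiv.addLeft m).tsum_eq (fun n : ℤ => ‖F (ω + n * T)‖ₑ)]
    refine tsum_congr fun n => ?_
    simp only [Equiv.coe_addLeft, Int.cast_add]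
    ring_nf
  have hm : ∀ n : ℤ, Measurable fun ω => F (ω + n * T) := fun n =>
    hF.comp (measurable_id.add_const _)
  have hm2 : ∀ n : ℤ, Measurable fun ω => ‖F (ω + n * T)‖ₑ := fun n => (hm n).enorm
  calc _ = ∫⁻ ω in Ioc 0 (0 + T), ∑' m : ℤ,
        ‖F (ω + m * T)‖ₑ * ∑' n : ℤ, ‖F (ω + m * T + n * T)‖ₑ := by
        simp only [hper, sq, ENNReal.tsum_mul_right]
    _ = ∑' m : ℤ, ∫⁻ ω in Ioc 0 (0 + T),
        ‖F (ω + m * T)‖ₑ * ∑' n : ℤ, ‖F (ω + m * T + n * T)‖ₑ := by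
        refine lintegral_tsum fun m => ?_
        simp only [hper]
        exact ((hm2 m).mul (Measurable.tsum hm2)).aemeasurable
    _ = ∫⁻ ω, ‖F ω‖ₑ * ∑' n : ℤ, ‖F (ω + n * T)‖ₑ :=
        (lintegral_eq_tsum_Ioc hT 0 (fun ω => ‖F ω‖ₑ * ∑' n : ℤ, ‖F (ω + n * T)‖ₑ)).symm
    _ = ∫⁻ ω, ∑' n : ℤ, ‖F ω * F (ω + n * T)‖ₑ := by
        simp only [enorm_mul, ENNReal.tsum_mul_left]
    _ = _ := lintegral_tsum fun n => (hF.mul (hm n)).enorm.aemeasurable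

/-- The sampled energies of a Fourier integral are bounded by the autocorrelation sums of `|F|`
over the lattice `Tℤ`: Parseval's identity for the `T`-periodization of `F`. -/
lemma tsum_enorm_sq_fourier_le {T : ℝ} (hT : 0 < T) {F : ℝ → ℂ} (hF : Measurable F)
    (hF1 : Integrable F) (x : ℝ) :
    ∑' k : ℤ, ‖𝓕 F (x - k * T⁻¹)‖ₑ ^ 2
      ≤ ∑' n : ℤ, ENNReal.ofReal T * ∫⁻ ω, ‖F ω * F (ω + n * T)‖ₑ := by
  rw [ENNReal.tsum_mul_left, ← lintegral_periodization_sq hT hF]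
  set G : ℝ → ℂ := fun ω => Real.fourierChar (-(ω * x)) • F ω with hGdef
  have hG1 : Integrable G := memLp_one_iff_integrable.1
    (memLp_fourierChar_smul (memLp_one_iff_integrable.2 hF1) x)
  have hGm : Measurable G := by
    have : Measurable fun ω : ℝ => (Real.fourierChar (-(ω * x)) : ℂ) :=
      Continuous.measurable (by fun_prop)
    exact this.mul hF
  have hGF : ∀ ω, ‖G ω‖ₑ = ‖F ω‖ₑ := fun ω => enorm_fourierChar_smul _ _
  simp only [← hGF]
  set S : ℝ → ℝ≥0∞ := fun ω => ∑' n : ℤ, ‖G (ω + n * T)‖ₑ with hS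
  have hGn : ∀ n : ℤ, Measurable fun ω => G (ω + n * T) := fun n =>
    hGm.comp (measurable_id.add_const _)
  have hSm : Measurable S := Measurable.tsum fun n => (hGn n).enorm
  by_cases htop : ∫⁻ ω in Ioc 0 (0 + T), S ω ^ 2 = ⊤
  · rw [htop, ENNReal.mul_top (by simpa using hT)]
    exact le_top
  set P : ℝ → ℂ := fun ω => ∑' n : ℤ, G (ω + n * T) with hP
  have hPS : ∀ ω, ‖P ω‖ₑ ≤ S ω := fun ω => enorm_tsum_le_tsum_enorm
  have hfin : ∫⁻ ω in Ioc 0 (0 + T), S ω ≠ ⊤ := by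
    rw [lintegral_tsum fun n => (hGn n).enorm.aemeasurable, ← lintegral_eq_tsum_Ioc hT 0 (‖G ·‖ₑ)]
    exact hG1.2.ne
  have hPm : AEStronglyMeasurable P (volume.restrict (Ioc 0 (0 + T))) := by
    refine aestronglyMeasurable_of_tendsto_ae (atTop : Filter (Finset ℤ))
      (f := fun s ω => ∑ n ∈ s, G (ω + n * T)) (fun s => ?_) ?_
    · exact (Finset.measurable_fun_sum s fun n _ => hGn n).aestronglyMeasurable
    · filter_upwards [ae_lt_top hSm hfin] with ω hω
      exact (Summable.of_enorm hω.ne).hasSum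
  have hP2 : MemLp P 2 (volume.restrict (Ioc 0 (0 + T))) := by
    refine ⟨hPm, (eLpNorm_lt_top_iff_lintegral_rpow_enorm_lt_top two_ne_zero (by simp)).2 ?_⟩
    refine lt_of_le_of_lt (lintegral_mono fun ω => ?_) (lt_top_iff_ne_top.2 htop)
    simpa using pow_le_pow_left' (hPS ω) 2
  have hcoef : ∀ k : ℤ, 𝓕 F (x - k * T⁻¹)
      = ∫ ω in Ioc 0 (0 + T), Real.fourierChar (ω * (k * T⁻¹)) • P ω := by
    intro k
    have hint : Integrable fun ω : ℝ => Real.fourierChar (ω * (k * T⁻¹)) • G ω := by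
      have := memLp_fourierChar_smul (memLp_one_iff_integrable.2 hG1) (-(k * T⁻¹))
      simpa using memLp_one_iff_integrable.1 this
    have hchar : ∀ (ω : ℝ) (n : ℤ), Real.fourierChar ((ω + n * T) * (k * T⁻¹))
        = Real.fourierChar (ω * (k * T⁻¹)) := by
      intro ω n
      have : (ω + n * T) * (k * T⁻¹) = ω * (k * T⁻¹) + ((n * k : ℤ) : ℝ) := by
        push_cast; field_simp
      rw [this, AddChar.map_add_eq_mul, (fourierChar_eq_one_iff _).2 ⟨_, rfl⟩, mul_one]
    rw [fourier_sub_eq_fourier_modulated, ← (hasSum_integral_Ioc hT 0 hint).tsum_eq]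
    simp only [hchar]
    rw [← integral_tsum]
    · refine integral_congr_ae ?_
      filter_upwards with ω
      simp only [Circle.smul_def, smul_eq_mul]
      rw [tsum_mul_left]
    · intro n
      have hc : Continuous fun ω : ℝ => (Real.fourierChar (ω * (k * T⁻¹)) : ℂ) := by fun_prop
      exact hc.aestronglyMeasurable.smul (hGn n).aestronglyMeasurable
    · simp only [enorm_fourierChar_smul]
      rw [← lintegral_eq_tsum_Ioc hT 0 (‖G ·‖ₑ)]
      exact hG1.2.ne
  simp only [hcoef]
  rw [tsum_enorm_sq_integral_Ioc hT 0 hP2]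
  gcongr with ω
  exact hPS ω

/-! ### The energy functions of a shift-invariant family -/

/-- The function `x ↦ ∑_{γ ∈ Γ} |⟨T_x f, T_γ g⟩|²` with values in `[0, ∞]`. -/
noncomputable def energy (Γ : Submodule ℤ ℝ) (f g : L2) (x : ℝ) : ℝ≥0∞ :=
  ∑' γ : Γ, ‖inner ℂ (translate (γ : ℝ) g) (translate x f)‖ₑ ^ 2

lemma energy_eq_tsum {Γ : Submodule ℤ ℝ} {c : ℝ} (hc : 0 < c)
    (hΓ : ∀ x, x ∈ Γ ↔ ∃ k : ℤ, x = k * c) (f g : L2) (x : ℝ) :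
    energy Γ f g x = ∑' k : ℤ, ‖𝓕 (crossSpectrum f g) (x - k * c)‖ₑ ^ 2 := by
  refine ((intMulEquiv (S := (Γ : Set ℝ)) hc.ne' hΓ).tsum_eq
    (fun γ : Γ => ‖inner ℂ (translate (γ : ℝ) g) (translate x f)‖ₑ ^ 2)).symm.trans ?_
  refine tsum_congr fun k => ?_
  rw [inner_translate]
  rfl

lemma measurable_energy {Γ : Submodule ℤ ℝ} {c : ℝ} (hc : 0 < c)
    (hΓ : ∀ x, x ∈ Γ ↔ ∃ k : ℤ, x = k * c) (f g : L2) : Measurable (energy Γ f g) := by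
  have h := continuous_fourier_crossSpectrum f g
  rw [funext (energy_eq_tsum hc hΓ f g)]
  exact Measurable.tsum fun k => Continuous.measurable (by fun_prop)

lemma measurable_crossSpectrum (f g : L2) : Measurable (crossSpectrum f g) :=
  (Measurable.inner (Lp.stronglyMeasurable _).measurable (Lp.stronglyMeasurable _).measurable)

lemma wTerm_self (Γ : Submodule ℤ ℝ) (f g : L2) (x : ℝ) :
    wTerm Γ f g g x = ((energy Γ f g x).toReal : ℂ) := by
  rw [energy, ENNReal.tsum_toReal_eq (fun _ => by simp), Complex.ofReal_tsum, wTerm]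
  refine tsum_congr fun γ => ?_
  rw [← inner_conj_symm (translate x f), Complex.mul_conj, Complex.normSq_eq_norm_sq]
  simp

/-- The frame inequalities, phrased for the translates of `f` and summed lattice by lattice. The
bound `‖g j‖² ≤ B` comes from testing the upper inequality on `g j` and keeping only the term
`|⟨g j, g j⟩|² = ‖g j‖⁴`. -/
lemma IsFrameGenerators.exists_bounds {Γ : J → Submodule ℤ ℝ} {g : J → L2}
    (h : IsFrameGenerators Γ g) :
    ∃ A B : ℝ, 0 < A ∧ (∀ f x, ENNReal.ofReal (A * ‖f‖ ^ 2) ≤ ∑' j, energy (Γ j) f (g j) x) ∧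
      (∀ f x, ∑' j, energy (Γ j) f (g j) x ≤ ENNReal.ofReal (B * ‖f‖ ^ 2)) ∧
      0 ≤ B ∧ ∀ j, ‖g j‖ ^ 2 ≤ B := by
  obtain ⟨A, B, hA, h⟩ := h
  have key : ∀ f x, ∑' j, energy (Γ j) f (g j) x
      = ENNReal.ofReal (∑' p, ‖inner ℂ (system Γ g p) (translate x f)‖ ^ 2) := by
    intro f x
    rw [ENNReal.ofReal_tsum_of_nonneg (fun _ => by positivity) (h _).1, ENNReal.tsum_sigma']
    simp only [ENNReal.ofReal_pow (norm_nonneg _), ofReal_norm]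
    rfl
  refine ⟨A, max B 0, hA, fun f x => ?_, fun f x => ?_, le_max_right _ _, fun j => ?_⟩
  · rw [key]
    refine ENNReal.ofReal_le_ofReal ?_
    simpa [norm_translate] using (h (translate x f)).2.1
  · rw [key]
    refine ENNReal.ofReal_le_ofReal (((h (translate x f)).2.2).trans ?_)
    rw [norm_translate]
    gcongr
    exact le_max_left _ _
  · obtain ⟨hs, -, hu⟩ := h (g j)
    have h0 : system Γ g ⟨j, 0⟩ = g j := by
      apply Lp.ext
      refine (translate_ae _ _).trans (.of_forall fun y => ?_)
      simp
    have h1 := hs.le_tsum ⟨j, 0⟩ (fun _ _ => by positivity)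
    simp only [h0, inner_self_eq_norm_sq_to_K, norm_pow, RCLike.norm_ofReal, abs_norm] at h1
    have h2 : ‖g j‖ ^ 2 * ‖g j‖ ^ 2 ≤ B * ‖g j‖ ^ 2 := by
      rw [← sq]; exact h1.trans hu
    rcases (sq_nonneg ‖g j‖).eq_or_lt with h3 | h3
    · rw [← h3]; exact le_max_right _ _
    · exact (le_of_mul_le_mul_right h2 h3).trans (le_max_left _ _)

lemma lintegral_enorm_sq_eq (g : L2) : ∫⁻ ω, ‖g ω‖ₑ ^ 2 = ENNReal.ofReal (‖g‖ ^ 2) := by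
  have h := Lp.enorm_def g
  rw [eLpNorm_eq_lintegral_rpow_enorm_toReal two_ne_zero (by simp)] at h
  rw [ENNReal.ofReal_pow (norm_nonneg _), ofReal_norm, h, ← ENNReal.rpow_natCast,
    ← ENNReal.rpow_mul]
  simp

/-- If `|f̂| ≤ 1` is carried by a bounded interval, the energy over a period of `Γ` is at most
`‖g‖²`. -/
lemma lintegral_energy_le {Γ : Submodule ℤ ℝ} {c : ℝ} (hc : 0 < c)
    (hΓ : ∀ x, x ∈ Γ ↔ ∃ k : ℤ, x = k * c) {T : ℝ} (hT : 0 < T) (u : ℝ) {f : L2} (g : L2)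
    (hf1 : ∀ᵐ ω, ‖(𝓕 f : L2) ω‖ₑ ≤ 1) (hf : ∀ᵐ ω, ω ∉ Ioc u (u + T) → (𝓕 f : L2) ω = 0)
    (a : ℝ) : ∫⁻ x in Ioc a (a + c), energy Γ f g x ≤ ENNReal.ofReal (‖g‖ ^ 2) := by
  have hcont := continuous_fourier_crossSpectrum f g
  have hle : ∀ᵐ ω, ‖crossSpectrum f g ω‖ₑ ≤ ‖(𝓕 g : L2) ω‖ₑ := by
    filter_upwards [hf1] with ω hω
    rw [enorm_crossSpectrum]
    exact mul_le_of_le_one_left' hω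
  have hs : ∀ᵐ ω, ω ∉ Ioc u (u + T) → crossSpectrum f g ω = 0 := by
    filter_upwards [hf] with ω hω hm
    rw [crossSpectrum, hω hm, inner_zero_right]
  have h2 : MemLp (crossSpectrum f g) 2 volume :=
    (Lp.memLp (𝓕 g : L2)).of_le (measurable_crossSpectrum f g).aestronglyMeasurable
      (by filter_upwards [hle] with ω hω using by simpa [← ofReal_norm] using hω)
  calc ∫⁻ x in Ioc a (a + c), energy Γ f g x
      = ∫⁻ x, ‖𝓕 (crossSpectrum f g) x‖ₑ ^ 2 := by
        simp only [energy_eq_tsum hc hΓ]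
        rw [lintegral_eq_tsum_Ioc hc a, ← lintegral_tsum (fun n => by fun_prop)]
        refine lintegral_congr fun x => ?_
        rw [← (Equiv.neg ℤ).tsum_eq]
        simp
    _ = ∫⁻ ω, ‖crossSpectrum f g ω‖ₑ ^ 2 :=
        lintegral_enorm_sq_fourier hT u h2 (integrable_crossSpectrum f g) hs
    _ ≤ ∫⁻ ω, ‖(𝓕 g : L2) ω‖ₑ ^ 2 := by
        refine lintegral_mono_ae ?_
        filter_upwards [hle] with ω hω using pow_le_pow_left' hω 2
    _ = ENNReal.ofReal (‖g‖ ^ 2) := by rw [lintegral_enorm_sq_eq, Lp.norm_fourier_eq]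

/-! ### Averaging and the lower bound on the bandwidth -/

lemma setLIntegral_Ioc_nat_mul_le {W : ℝ → ℝ≥0∞} {c : ℝ} (hc : 0 < c) {b : ℝ≥0∞}
    (hW : ∀ a, ∫⁻ x in Ioc a (a + c), W x ≤ b) (a : ℝ) (N : ℕ) :
    ∫⁻ x in Ioc a (a + N * c), W x ≤ N * b := by
  induction N with
  | zero => simp
  | succ N ih =>
    have h1 : a ≤ a + N * c := by simp only [le_add_iff_nonneg_right]; positivity
    have h2 : a + N * c ≤ a + N * c + c := by linarith
    have h3 : a + ((N + 1 : ℕ) : ℝ) * c = a + N * c + c := by push_cast; ring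
    rw [h3, ← Ioc_union_Ioc_eq_Ioc h1 h2]
    refine (lintegral_union_le _ _ _).trans ?_
    push_cast
    rw [add_mul, one_mul]
    exact add_le_add ih (hW _)

lemma setLIntegral_Ioc_le {W : ℝ → ℝ≥0∞} {c : ℝ} (hc : 0 < c) {b : ℝ} (hb : 0 ≤ b)
    (hW : ∀ a, ∫⁻ x in Ioc a (a + c), W x ≤ ENNReal.ofReal b) {L : ℝ} (hL : 0 ≤ L) (a : ℝ) :
    ∫⁻ x in Ioc a (a + L), W x ≤ ENNReal.ofReal ((L / c + 1) * b) := by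
  have hN : L ≤ ⌈L / c⌉₊ * c := (div_le_iff₀ hc).1 (Nat.le_ceil _)
  calc _ ≤ ∫⁻ x in Ioc a (a + ⌈L / c⌉₊ * c), W x :=
        lintegral_mono_set (Ioc_subset_Ioc_right (by linarith))
    _ ≤ ⌈L / c⌉₊ * ENNReal.ofReal b := setLIntegral_Ioc_nat_mul_le hc hW a _
    _ = ENNReal.ofReal (⌈L / c⌉₊ * b) := by
        rw [ENNReal.ofReal_mul (by positivity), ENNReal.ofReal_natCast]
    _ ≤ _ := by
        refine ENNReal.ofReal_le_ofReal (mul_le_mul_of_nonneg_right ?_ hb)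
        exact (Nat.ceil_lt_add_one (by positivity)).le

/-- If finitely many functions `W j`, each with integral at most `b` over intervals of length
`c j`, together with a remainder of mean at most one, dominate the constant `V`, then averaging over
long intervals bounds `V`. -/
lemma le_one_add_sum_of_averages (S : Finset J) {c : J → ℝ} (hc : ∀ j, 0 < c j) {b : ℝ}
    (hb : 0 ≤ b) {W : J → ℝ → ℝ≥0∞} (hWm : ∀ j, Measurable (W j))
    (hW : ∀ j a, ∫⁻ x in Ioc a (a + c j), W j x ≤ ENNReal.ofReal b)
    {R : ℝ → ℝ≥0∞} {V : ℝ} (hV : ∀ x, ENNReal.ofReal V ≤ R x + ∑ j ∈ S, W j x)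
    (hR : ∀ᶠ n : ℕ in atTop, ∫⁻ x in Ioc (-(n : ℝ)) n, R x ≤ ENNReal.ofReal (2 * n)) :
    V ≤ 1 + b * ∑ j ∈ S, (c j)⁻¹ := by
  have hev : ∀ᶠ n : ℕ in atTop, V ≤ 1 + b * ∑ j ∈ S, (c j)⁻¹ + b * S.card / 2 / (n : ℝ) := by
    filter_upwards [hR, eventually_gt_atTop 0] with n hn hpos
    have hn0 : (0 : ℝ) < n := by exact_mod_cast hpos
    have hlen : (n : ℝ) = -(n : ℝ) + 2 * n := by ring
    have h1 : ENNReal.ofReal (V * (2 * n))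
        ≤ ENNReal.ofReal (2 * n + ∑ j ∈ S, (2 * n / c j + 1) * b) := by
      calc ENNReal.ofReal (V * (2 * n)) = ∫⁻ x in Ioc (-(n : ℝ)) n, ENNReal.ofReal V := by
            rw [setLIntegral_const, Real.volume_Ioc, ENNReal.ofReal_mul' (by positivity)]
            congr 2; ring
        _ ≤ ∫⁻ x in Ioc (-(n : ℝ)) n, (R x + ∑ j ∈ S, W j x) := lintegral_mono fun x => hV x
        _ = (∫⁻ x in Ioc (-(n : ℝ)) n, R x) + ∑ j ∈ S, ∫⁻ x in Ioc (-(n : ℝ)) n, W j x := by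
            rw [lintegral_add_right _ (Finset.measurable_fun_sum S fun j _ => hWm j),
              lintegral_finsetSum _ fun j _ => hWm j]
        _ ≤ ENNReal.ofReal (2 * n) + ∑ j ∈ S, ENNReal.ofReal ((2 * n / c j + 1) * b) := by
            refine add_le_add hn (Finset.sum_le_sum fun j _ => ?_)
            have := setLIntegral_Ioc_le (hc j) hb (hW j) (L := 2 * n) (by positivity) (-(n : ℝ))
            rwa [← hlen] at this
        _ = _ := by
            have hnn : ∀ j ∈ S, 0 ≤ (2 * n / c j + 1) * b := fun j _ => by
              have := hc j; positivity
            rw [ENNReal.ofReal_add (by positivity) (Finset.sum_nonneg hnn),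
              ENNReal.ofReal_sum_of_nonneg hnn]
    have h2 : V * (2 * n) ≤ 2 * n + ∑ j ∈ S, (2 * n / c j + 1) * b := by
      refine (ENNReal.ofReal_le_ofReal_iff ?_).1 h1
      exact add_nonneg (by positivity) (Finset.sum_nonneg fun j _ => by
        have := hc j; positivity)
    have h3 : 2 * n + ∑ j ∈ S, (2 * n / c j + 1) * b
        = (1 + b * ∑ j ∈ S, (c j)⁻¹ + b * S.card / 2 / (n : ℝ)) * (2 * n) := by
      simp only [add_mul, Finset.sum_add_distrib, one_mul, Finset.sum_const, nsmul_eq_mul,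
        div_eq_mul_inv, mul_right_comm _ _ b]
      rw [← Finset.mul_sum]
      field_simp
      ring
    rw [h3] at h2
    exact le_of_mul_le_mul_right h2 (by positivity)
  have hlim : Tendsto (fun n : ℕ => 1 + b * ∑ j ∈ S, (c j)⁻¹ + b * S.card / 2 / (n : ℝ)) atTop
      (𝓝 (1 + b * ∑ j ∈ S, (c j)⁻¹ + 0)) :=
    tendsto_const_nhds.add (tendsto_const_div_atTop_nhds_zero_nat _)
  rw [add_zero] at hlim
  exact ge_of_tendsto hlim hev

/-- The bandlimited test function whose Fourier transform is the indicator of a compact set. -/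
lemma exists_testSpace_indicator {E K : Set ℝ} (hK : IsCompact K) (hKE : K ⊆ Eᶜ) :
    ∃ f ∈ testSpace E, (𝓕 f : L2) =ᵐ[volume] K.indicator (fun _ => (1 : ℂ)) ∧
      ‖f‖ ^ 2 = volume.real K := by
  set χ : L2 := indicatorConstLp 2 hK.measurableSet hK.measure_lt_top.ne (1 : ℂ) with hχ
  have hχa : χ =ᵐ[volume] K.indicator (fun _ => (1 : ℂ)) := indicatorConstLp_coeFn
  have hF : (𝓕 ((Lp.fourierTransformₗᵢ ℝ ℂ).symm χ) : L2) = χ :=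
    (Lp.fourierTransformₗᵢ ℝ ℂ).apply_symm_apply χ
  refine ⟨(Lp.fourierTransformₗᵢ ℝ ℂ).symm χ, ⟨?_, K, hK, hKE, ?_⟩, ?_, ?_⟩
  · rw [hF]
    refine (memLp_congr_ae hχa).2 ?_
    exact memLp_indicator_const ∞ hK.measurableSet 1 (Or.inr hK.measure_lt_top.ne)
  · rw [hF]
    filter_upwards [hχa] with ω hω
    by_cases hm : ω ∈ K
    · rw [indicator_of_mem hm]
    · rw [indicator_of_notMem hm, hω, indicator_of_notMem hm]
  · rw [hF]; exact hχa
  · rw [LinearIsometryEquiv.norm_map, hχ, norm_indicatorConstLp two_ne_zero (by simp)]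
    simp only [norm_one, one_mul, ENNReal.toReal_ofNat]
    rw [← Real.rpow_natCast, ← Real.rpow_mul measureReal_nonneg]
    simp

/-- Suppose that, for test functions, the energies outside some finite set of lattices have mean at
most one. If `(g_j)` is a system of frame generators, then averaging the lower frame inequality for
`f̂ = 1_K` gives `A vol(K) ≤ 1 + B ∑ 1 / covol(Γ_j)`; since `vol(K)` is arbitrarily large, the
bandwidth is infinite. -/
lemma bandwidth_eq_top_of_remainder (Γ : J → Submodule ℤ ℝ)
    [∀ j, DiscreteTopology (Γ j)] [∀ j, IsZLattice ℝ (Γ j)] {E : Set ℝ} (hE : IsClosed E)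
    (hE0 : volume E = 0) {g : J → L2} (hg : IsFrameGenerators Γ g)
    (H : ∀ f ∈ testSpace E, ∃ (S : Finset J) (R : ℝ → ℝ≥0∞),
      (∀ x, ∑' j, energy (Γ j) f (g j) x ≤ R x + ∑ j ∈ S, energy (Γ j) f (g j) x) ∧
      ∀ᶠ n : ℕ in atTop, ∫⁻ x in Ioc (-(n : ℝ)) n, R x ≤ ENNReal.ofReal (2 * n)) :
    bandwidth Γ = ⊤ := by
  by_contra hfin
  choose c hc hcov hΓ using fun j => exists_generator (Γ j)
  obtain ⟨A, B, hA, hlow, -, hB, hgB⟩ := hg.exists_bounds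
  have hsum : ∀ S : Finset J, ∑ j ∈ S, (c j)⁻¹ ≤ (bandwidth Γ).toReal := by
    intro S
    refine (ENNReal.ofReal_le_iff_le_toReal hfin).1 ?_
    rw [ENNReal.ofReal_sum_of_nonneg fun j _ => (inv_pos.2 (hc j)).le, bandwidth]
    simp only [hcov, one_div]
    exact ENNReal.sum_le_tsum S
  have hvol : volume Eᶜ = ⊤ := by
    have := measure_add_measure_compl (μ := volume) hE.measurableSet
    rw [hE0, zero_add, Real.volume_univ] at this
    exact this
  -- `K` is chosen so large that `A vol(K)` exceeds the bound obtained by averaging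
  obtain ⟨K, hKE, hK, hKvol⟩ := hE.isOpen_compl.exists_lt_isCompact (μ := volume)
    (r := ENNReal.ofReal ((1 + B * (bandwidth Γ).toReal) / A))
    (by rw [hvol]; exact ENNReal.ofReal_lt_top)
  obtain ⟨f, hf, hfK, hfn⟩ := exists_testSpace_indicator hK hKE
  obtain ⟨S, R, hSR, hR⟩ := H f hf
  obtain ⟨r, hr⟩ := hK.isBounded.subset_ball 0
  obtain ⟨T, u, hT, hKu⟩ : ∃ T u : ℝ, 0 < T ∧ K ⊆ Ioc u (u + T) := by
    refine ⟨2 * |r| + 1, -|r|, by positivity, fun x hx => ?_⟩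
    have h1 := hr hx
    rw [mem_ball_zero_iff, Real.norm_eq_abs, abs_lt] at h1
    have h2 := le_abs_self r
    constructor <;> linarith
  have hf1 : ∀ᵐ ω, ‖(𝓕 f : L2) ω‖ₑ ≤ 1 := by
    filter_upwards [hfK] with ω hω
    rw [hω]
    by_cases hm : ω ∈ K
    · rw [indicator_of_mem hm]; simp
    · rw [indicator_of_notMem hm]; simp
  have hf0 : ∀ᵐ ω, ω ∉ Ioc u (u + T) → (𝓕 f : L2) ω = 0 := by
    filter_upwards [hfK] with ω hω hm
    rw [hω, indicator_of_notMem fun h => hm (hKu h)]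
  have hle := le_one_add_sum_of_averages S hc hB
    (fun j => measurable_energy (hc j) (hΓ j) f (g j))
    (fun j a => (lintegral_energy_le (hc j) (hΓ j) hT u (g j) hf1 hf0 a).trans
      (ENNReal.ofReal_le_ofReal (hgB j)))
    (fun x => (hlow f x).trans (hSR x)) hR
  rw [hfn] at hle
  have h1 : (1 + B * (bandwidth Γ).toReal) / A < volume.real K := by
    have := (ENNReal.ofReal_lt_iff_lt_toReal (by positivity) hK.measure_lt_top.ne).1 hKvol
    exact this
  rw [div_lt_iff₀ hA] at h1
  have h2 := mul_le_mul_of_nonneg_left (hsum S) hB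
  linarith

/-! ### Infinite bandwidth from the integrability and convergence conditions -/

/-- Here the energies outside a finite set of lattices are uniformly at most one, being bounded by
a tail of the series in the `α`-LIC. -/
lemma AlphaLIC.bandwidth_eq_top {Γ : J → Submodule ℤ ℝ}
    [∀ j, DiscreteTopology (Γ j)] [∀ j, IsZLattice ℝ (Γ j)] {E : Set ℝ} (hE : IsClosed E)
    (hE0 : volume E = 0) {g : J → L2} (hg : IsFrameGenerators Γ g) (h : AlphaLIC E Γ g) :
    bandwidth Γ = ⊤ := by
  refine bandwidth_eq_top_of_remainder Γ hE hE0 hg fun f hf => ?_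
  choose c hc hcov hΓ using fun j => exists_generator (Γ j)
  set D : J → ℝ≥0∞ := fun j => ∑' α : annihilator (Γ j),
      ENNReal.ofReal (1 / ZLattice.covolume (Γ j)) *
        ∫⁻ ω : ℝ, ‖(𝓕 f : L2) ω * (𝓕 (g j) : L2) ω *
          (𝓕 f : L2) (ω + (α : ℝ)) * (𝓕 (g j) : L2) (ω + (α : ℝ))‖ₑ with hD
  have hDfin : ∑' j, D j ≠ ⊤ := (h f hf).ne
  have hle : ∀ j x, energy (Γ j) f (g j) x ≤ D j := by
    intro j x
    have h1 := tsum_enorm_sq_fourier_le (inv_pos.2 (hc j)) (measurable_crossSpectrum f (g j))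
      (integrable_crossSpectrum f (g j)) x
    rw [inv_inv] at h1
    rw [energy_eq_tsum (hc j) (hΓ j)]
    refine h1.trans_eq ?_
    rw [hD]
    refine Eq.trans ?_ ((intMulEquiv (inv_pos.2 (hc j)).ne'
      (mem_annihilator_iff (hc j) (hΓ j))).tsum_eq (fun α : annihilator (Γ j) => _))
    refine tsum_congr fun n => ?_
    rw [hcov, one_div]
    congr 1
    refine lintegral_congr fun ω => ?_
    simp only [enorm_mul, enorm_crossSpectrum, coe_intMulEquiv]
    ring
  obtain ⟨S, hS⟩ := ((ENNReal.tendsto_tsum_compl_atTop_zero hDfin).eventually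
    (ge_mem_nhds (zero_lt_one' ℝ≥0∞))).exists
  refine ⟨S, fun _ => 1, fun x => ?_, .of_forall fun n => ?_⟩
  · rw [← ENNReal.sum_add_tsum_compl S, add_comm]
    exact add_le_add_left ((ENNReal.tsum_le_tsum fun j => hle _ x).trans hS) _
  · rw [setLIntegral_one, Real.volume_Ioc]
    apply le_of_eq; congr 1; ring

/-- The remainder is `|w - ∑_{j ∈ S} w_j|`, whose mean the `1`-UCP controls; boundedness of the
energy functions makes it integrable, so that the mean is not a junk value. -/
lemma OneUCP.bandwidth_eq_top {Γ : J → Submodule ℤ ℝ}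
    [∀ j, DiscreteTopology (Γ j)] [∀ j, IsZLattice ℝ (Γ j)] {E : Set ℝ} (hE : IsClosed E)
    (hE0 : volume E = 0) {g : J → L2} (hg : IsFrameGenerators Γ g) (h : OneUCP E Γ g) :
    bandwidth Γ = ⊤ := by
  refine bandwidth_eq_top_of_remainder Γ hE hE0 hg fun f hf => ?_
  choose c hc hcov hΓ using fun j => exists_generator (Γ j)
  obtain ⟨A, B, -, -, hup, -, -⟩ := hg.exists_bounds
  obtain ⟨w, hw, -, hmean⟩ := h f hf
  obtain ⟨S, hS⟩ := hmean 1 one_pos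
  obtain ⟨m, hm1, hm⟩ := hS S subset_rfl
  simp only [wTerm_self] at hw hm
  have hfin : ∀ x, ∑' j, energy (Γ j) f (g j) x ≠ ⊤ := fun x =>
    ((hup f x).trans_lt ENNReal.ofReal_lt_top).ne
  have hjfin : ∀ j x, energy (Γ j) f (g j) x ≠ ⊤ := fun j x =>
    ENNReal.ne_top_of_tsum_ne_top (hfin x) j
  have hwx : ∀ x, ‖w x‖ₑ = ∑' j, energy (Γ j) f (g j) x := by
    intro x
    rw [← (hw x).tsum_eq, ← Complex.ofReal_tsum, ← ENNReal.tsum_toReal_eq (fun j => hjfin j x),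
      ← ofReal_norm, Complex.norm_real, Real.norm_of_nonneg ENNReal.toReal_nonneg,
      ENNReal.ofReal_toReal (hfin x)]
  have hje : ∀ j x, ‖((energy (Γ j) f (g j) x).toReal : ℂ)‖ₑ = energy (Γ j) f (g j) x := by
    intro j x
    rw [← ofReal_norm, Complex.norm_real, Real.norm_of_nonneg ENNReal.toReal_nonneg,
      ENNReal.ofReal_toReal (hjfin j x)]
  set R : ℝ → ℂ := fun x => w x - ∑ j ∈ S, ((energy (Γ j) f (g j) x).toReal : ℂ) with hRdef
  have hRm : Measurable R := by
    refine w.continuous.measurable.sub (Finset.measurable_fun_sum S fun j _ => ?_)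
    exact Complex.measurable_ofReal.comp (measurable_energy (hc j) (hΓ j) f (g j)).ennreal_toReal
  have hRle : ∀ x, ‖R x‖ ≤ ‖w‖ + S.card * (ENNReal.ofReal (B * ‖f‖ ^ 2)).toReal := by
    intro x
    refine (norm_sub_le _ _).trans (add_le_add (w.norm_coe_le_norm x) ?_)
    refine (norm_sum_le _ _).trans ?_
    rw [← nsmul_eq_mul]
    refine Finset.sum_le_card_nsmul _ _ _ fun j _ => ?_
    rw [Complex.norm_real, Real.norm_of_nonneg ENNReal.toReal_nonneg]
    exact ENNReal.toReal_mono ENNReal.ofReal_ne_top ((ENNReal.le_tsum j).trans (hup f x))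
  refine ⟨S, fun x => ‖R x‖ₑ, fun x => ?_, ?_⟩
  · rw [← hwx]
    calc ‖w x‖ₑ = ‖R x + ∑ j ∈ S, ((energy (Γ j) f (g j) x).toReal : ℂ)‖ₑ := by
          rw [hRdef]; simp
      _ ≤ _ := (enorm_add_le _ _).trans (add_le_add_right
          ((enorm_sum_le _ _).trans_eq (Finset.sum_congr rfl fun j _ => hje j x)) _)
  · filter_upwards [hm.eventually (gt_mem_nhds hm1), eventually_gt_atTop 0] with n hn hpos
    have hn0 : (0 : ℝ) < n := by exact_mod_cast hpos
    have hint : Integrable R (volume.restrict (Ioc (-(n : ℝ)) n)) :=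
      Measure.integrableOn_of_bounded (by simp) hRm.aestronglyMeasurable (.of_forall hRle)
    rw [intervalIntegral.integral_of_le (by linarith), one_div, inv_mul_lt_iff₀ (by positivity),
      mul_one] at hn
    simp only [← ofReal_norm]
    rw [← ofReal_integral_eq_lintegral_ofReal hint.norm (.of_forall fun _ => norm_nonneg _)]
    exact ENNReal.ofReal_le_ofReal hn.le

/-- The arithmetic-geometric mean inequality bounds each `α`-term by the average of the `α`-term
and the `-α`-term of the local integrability condition. -/
lemma LIC.alphaLIC {Γ : J → Submodule ℤ ℝ} {E : Set ℝ} {g : J → L2} (h : LIC E Γ g) :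
    AlphaLIC E Γ g := by
  intro f hf
  refine lt_of_le_of_lt ?_ (h f hf)
  refine ENNReal.tsum_le_tsum fun j => ?_
  set a := (𝓕 f : L2) with ha
  set b := (𝓕 (g j) : L2) with hb
  have ham : Measurable a := (Lp.stronglyMeasurable _).measurable
  have hbm : Measurable b := (Lp.stronglyMeasurable _).measurable
  have hneg : ∀ α, α ∈ annihilator (Γ j) → -α ∈ annihilator (Γ j) := by
    intro α hα γ hγ
    rw [mul_neg, ← neg_mul]
    exact hα _ (neg_mem hγ)
  let e : annihilator (Γ j) ≃ annihilator (Γ j) :=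
    { toFun := fun α => ⟨-α, hneg _ α.2⟩
      invFun := fun α => ⟨-α, hneg _ α.2⟩
      left_inv := fun α => by simp
      right_inv := fun α => by simp }
  set I : annihilator (Γ j) → ℝ≥0∞ := fun α => ∫⁻ ω : ℝ, ‖a ω * a (ω + (α : ℝ))‖ₑ * ‖b ω‖ₑ ^ 2
    with hI
  have hshift : ∀ α : annihilator (Γ j),
      ∫⁻ ω : ℝ, ‖a ω * a (ω + (α : ℝ))‖ₑ * ‖b (ω + (α : ℝ))‖ₑ ^ 2 = I (e α) := by
    intro α
    refine Eq.trans ?_ (lintegral_add_right_eq_self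
      (fun ω : ℝ => ‖a ω * a (ω + (e α : ℝ))‖ₑ * ‖b ω‖ₑ ^ 2) (α : ℝ))
    refine lintegral_congr fun ω => ?_
    simp [e, enorm_mul, mul_comm]
  have hmul : ∀ α : annihilator (Γ j),
      2 * ∫⁻ ω : ℝ, ‖a ω * b ω * a (ω + (α : ℝ)) * b (ω + (α : ℝ))‖ₑ ≤ I α + I (e α) := by
    intro α
    rw [← hshift, ← lintegral_const_mul' _ _ (by simp), hI, ← lintegral_add_left]
    · refine lintegral_mono fun ω => ?_
      simp only [enorm_mul, ← mul_add]
      calc _ = ‖a ω‖ₑ * ‖a (ω + (α : ℝ))‖ₑ * (2 * ‖b ω‖ₑ * ‖b (ω + (α : ℝ))‖ₑ) := by ring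
        _ ≤ _ := by
          gcongr
          simp only [enorm_eq_nnnorm]
          exact_mod_cast two_mul_le_add_sq ‖b ω‖₊ ‖b (ω + (α : ℝ))‖₊
    · exact (ham.mul (ham.comp (measurable_id.add_const _))).enorm.mul (hbm.enorm.pow_const 2)
  rw [ENNReal.tsum_mul_left, ENNReal.tsum_mul_left]
  refine mul_le_mul_right ?_ _
  have h2 : 2 * ∑' α : annihilator (Γ j),
      ∫⁻ ω : ℝ, ‖a ω * b ω * a (ω + (α : ℝ)) * b (ω + (α : ℝ))‖ₑ ≤ 2 * ∑' α, I α := by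
    rw [← ENNReal.tsum_mul_left, two_mul (∑' α, I α)]
    nth_rewrite 2 [← e.tsum_eq I]
    rw [← ENNReal.tsum_add]
    exact ENNReal.tsum_le_tsum hmul
  exact (ENNReal.mul_le_mul_iff_right two_ne_zero (by simp)).1 h2

/-! ### Tiling the line by intervals of prescribed lengths -/

lemma exists_disjoint_finsets_of_tsum_eq_top {a : J → ℝ≥0∞} (ha : ∀ j, a j ≠ ⊤)
    (h : ∑' j, a j = ⊤) :
    ∃ F : ℤ → Finset J, Pairwise (Function.onFun Disjoint F) ∧ ∀ n, 1 ≤ ∑ j ∈ F n, a j := by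
  classical
  obtain ⟨F, hF1, hF⟩ := exists_seq_of_forall_finset_exists
    (fun S : Finset J => 1 ≤ ∑ j ∈ S, a j) Disjoint (fun s _ => by
      have h1 : ∑' j : ↥((s.biUnion id : Finset J) : Set J)ᶜ, a j = ⊤ := by
        have h2 := ENNReal.sum_add_tsum_compl (s.biUnion id) a
        rw [h, ENNReal.add_eq_top] at h2
        exact h2.resolve_left (ENNReal.sum_ne_top.2 fun j _ => ha j)
      rw [ENNReal.tsum_eq_iSup_sum] at h1
      obtain ⟨t, ht⟩ := lt_iSup_iff.1 (h1 ▸ ENNReal.one_lt_top)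
      refine ⟨t.map (Function.Embedding.subtype _), ?_, fun x hx => ?_⟩
      · rw [Finset.sum_map]
        exact ht.le
      · rw [Finset.disjoint_right]
        intro j hj hjx
        obtain ⟨i, -, rfl⟩ := Finset.mem_map.1 hj
        exact i.2 (Finset.mem_coe.2 (Finset.mem_biUnion.2 ⟨x, hx, hjx⟩)))
  refine ⟨fun n => F (Equiv.intEquivNat n), fun m n hmn => ?_, fun n => hF1 _⟩
  rcases lt_or_gt_of_ne (Equiv.intEquivNat.injective.ne hmn) with hlt | hlt
  · exact hF _ _ hlt
  · exact (hF _ _ hlt).symm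

/-- An interval is tiled by consecutive half-open intervals whose lengths are bounded by given
numbers with large enough sum. -/
lemma exists_tiling_Ioc {ℓ : J → ℝ} (hℓ : ∀ j, 0 ≤ ℓ j) (F : Finset J) {u v : ℝ} (huv : u ≤ v)
    (h : v - u ≤ ∑ j ∈ F, ℓ j) :
    ∃ p q : J → ℝ, (∀ j, q j ≤ p j + ℓ j) ∧
      (∀ i ∈ F, ∀ j ∈ F, i ≠ j → Disjoint (Ioc (p i) (q i)) (Ioc (p j) (q j))) ∧
      ⋃ j ∈ F, Ioc (p j) (q j) = Ioc u v := by
  classical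
  induction F using Finset.induction_on generalizing v with
  | empty =>
    refine ⟨0, 0, by simpa using hℓ, by simp, ?_⟩
    rw [Ioc_eq_empty (by simpa using h)]
    simp
  | insert i F hi ih =>
    rw [Finset.sum_insert hi] at h
    have hum : u ≤ max u (v - ℓ i) := le_max_left _ _
    have hmv : max u (v - ℓ i) ≤ v := max_le huv (by linarith [hℓ i])
    have hvm : v - ℓ i ≤ max u (v - ℓ i) := le_max_right _ _
    have hsum : 0 ≤ ∑ j ∈ F, ℓ j := Finset.sum_nonneg fun j _ => hℓ j
    obtain ⟨p, q, h1, h2, h3⟩ := ih hum (by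
      rcases max_choice u (v - ℓ i) with h' | h' <;> rw [h'] <;> linarith)
    have hne : ∀ j ∈ F, j ≠ i := fun j hj hji => hi (hji ▸ hj)
    have hdisj : ∀ j ∈ F, Disjoint (Ioc (p j) (q j)) (Ioc (max u (v - ℓ i)) v) := fun j hj => by
      refine Disjoint.mono_left (h3 ▸ subset_biUnion_of_mem (u := fun j => Ioc (p j) (q j)) hj) ?_
      exact Ioc_disjoint_Ioc_of_le le_rfl
    refine ⟨Function.update p i (max u (v - ℓ i)), Function.update q i v, fun j => ?_,
      fun a ha b hb hab => ?_, ?_⟩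
    · by_cases hj : j = i
      · subst hj; simp only [Function.update_self]; linarith
      · simpa [Function.update_of_ne hj] using h1 j
    · rcases Finset.mem_insert.1 ha with rfl | ha' <;> rcases Finset.mem_insert.1 hb with rfl | hb'
      · exact absurd rfl hab
      · simpa [Function.update_of_ne (hne b hb')] using (hdisj b hb').symm
      · simpa [Function.update_of_ne (hne a ha')] using hdisj a ha'
      · simpa [Function.update_of_ne (hne a ha'), Function.update_of_ne (hne b hb')]
          using h2 a ha' b hb' hab
    · rw [Finset.set_biUnion_insert, Function.update_self, Function.update_self,
        ← Ioc_union_Ioc_eq_Ioc hum hmv, ← h3, union_comm]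
      congr 1
      refine iUnion₂_congr fun j hj => ?_
      rw [Function.update_of_ne (hne j hj), Function.update_of_ne (hne j hj)]

/-- If lengths `ℓ j` have infinite sum, the line has a locally finite tiling by half-open
intervals, the `j`-th of length at most `ℓ j` (possibly empty): each unit interval is tiled by a
finite subfamily of its own. -/
lemma exists_tiling_real {ℓ : J → ℝ} (hℓ : ∀ j, 0 ≤ ℓ j) (h : ∑' j, ENNReal.ofReal (ℓ j) = ⊤) :
    ∃ p q : J → ℝ, (∀ j, q j ≤ p j + ℓ j) ∧
      Pairwise (Function.onFun Disjoint fun j => Ioc (p j) (q j)) ∧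
      ⋃ j, Ioc (p j) (q j) = univ ∧
      ∀ r : ℝ, {j | (Ioc (p j) (q j) ∩ Ioc (-r) r).Nonempty}.Finite := by
  obtain ⟨F, hFd, hF⟩ := exists_disjoint_finsets_of_tsum_eq_top (fun _ => ENNReal.ofReal_ne_top) h
  have hF' : ∀ n : ℤ, ((n : ℝ) + 1) - n ≤ ∑ j ∈ F n, ℓ j := by
    intro n
    have := hF n
    rw [← ENNReal.ofReal_sum_of_nonneg fun j _ => hℓ j, ENNReal.one_le_ofReal] at this
    linarith
  choose P Q hPQ hd hU using fun n : ℤ =>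
    exists_tiling_Ioc hℓ (F n) (by linarith : (n : ℝ) ≤ n + 1) (hF' n)
  have hex : ∀ j, ∃ a b : ℝ, b ≤ a + ℓ j ∧ (∀ n, j ∈ F n → a = P n j ∧ b = Q n j) ∧
      ((∀ n, j ∉ F n) → Ioc a b = ∅) := by
    intro j
    by_cases hj : ∃ n, j ∈ F n
    · obtain ⟨n, hn⟩ := hj
      refine ⟨P n j, Q n j, hPQ n j, fun m hm => ?_, fun h' => absurd hn (h' n)⟩
      have : m = n := by
        by_contra hmn
        exact Finset.disjoint_left.1 (hFd hmn) hm hn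
      subst this
      exact ⟨rfl, rfl⟩
    · push Not at hj
      exact ⟨0, 0, by simpa using hℓ j, fun n hn => absurd hn (hj n), fun _ => by simp⟩
  choose p q hpq hin hout using hex
  have hI : ∀ n, ∀ j ∈ F n, Ioc (p j) (q j) = Ioc (P n j) (Q n j) := fun n j hj => by
    rw [(hin j n hj).1, (hin j n hj).2]
  have hsub : ∀ n, ∀ j ∈ F n, Ioc (p j) (q j) ⊆ Ioc (n : ℝ) (n + 1) := fun n j hj => by
    rw [hI n j hj, ← hU n]
    exact subset_biUnion_of_mem (u := fun j => Ioc (P n j) (Q n j)) hj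
  have hmem : ∀ j x, x ∈ Ioc (p j) (q j) → ∃ n, j ∈ F n := by
    intro j x hx
    by_contra h'
    push Not at h'
    rw [hout j h'] at hx
    exact hx
  refine ⟨p, q, hpq, fun i j hij => ?_, ?_, fun r => ?_⟩
  · rw [Function.onFun, disjoint_left]
    intro x hxi hxj
    obtain ⟨m, hm⟩ := hmem i x hxi
    obtain ⟨n, hn⟩ := hmem j x hxj
    by_cases hmn : m = n
    · subst hmn
      have := hd m i hm j hn hij
      rw [← hI m i hm, ← hI m j hn] at this
      exact disjoint_left.1 this hxi hxj
    · have := pairwise_disjoint_Ioc_intCast ℝ hmn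
      exact disjoint_left.1 this (hsub m i hm hxi) (hsub n j hn hxj)
  · rw [eq_univ_iff_forall]
    intro x
    have hx : x ∈ ⋃ n : ℤ, Ioc (n : ℝ) (n + 1) := by rw [iUnion_Ioc_intCast]; trivial
    obtain ⟨n, hn⟩ := mem_iUnion.1 hx
    rw [← hU n] at hn
    obtain ⟨j, hj, hxj⟩ := mem_iUnion₂.1 hn
    exact mem_iUnion.2 ⟨j, by rwa [hI n j hj]⟩
  · refine ((Finset.Icc (-⌈|r|⌉ - 1) ⌈|r|⌉).finite_toSet.biUnion
      (t := fun n => (F n : Set J)) fun n _ => (F n).finite_toSet).subset ?_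
    rintro j ⟨x, hxj, hxr⟩
    obtain ⟨n, hn⟩ := hmem j x hxj
    have hxn := hsub n j hn hxj
    refine mem_biUnion (x := n) ?_ hn
    have h1 := Int.le_ceil |r|
    have h2 := le_abs_self r
    rw [Finset.mem_coe, Finset.mem_Icc]
    constructor
    · have h3 : ((-⌈|r|⌉ - 1 : ℤ) : ℝ) < n := by push_cast; linarith [hxn.2, hxr.1]
      exact (Int.cast_lt.1 h3).le
    · have h3 : (n : ℝ) < ⌈|r|⌉ := by linarith [hxn.1, hxr.2]
      exact (Int.cast_lt.1 h3).le

/-- A locally finite family of pairwise disjoint sets covering the line has only countably many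
nonempty members, so the integrals over them add up even if the index set is uncountable. -/
lemma tsum_setLIntegral_of_locallyFinite {I : J → Set ℝ} (hm : ∀ j, MeasurableSet (I j))
    (hd : Pairwise (Function.onFun Disjoint I)) (hU : ⋃ j, I j = univ)
    (hfin : ∀ r : ℝ, {j | (I j ∩ Ioc (-r) r).Nonempty}.Finite) (φ : ℝ → ℝ≥0∞) :
    ∑' j, ∫⁻ x in I j, φ x = ∫⁻ x, φ x := by
  set N : Set J := {j | (I j).Nonempty} with hN
  have hcount : N.Countable := by
    refine (countable_iUnion fun n : ℕ => (hfin n).countable).mono ?_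
    rintro j ⟨x, hx⟩
    obtain ⟨n, hn⟩ := exists_nat_gt |x|
    exact mem_iUnion.2 ⟨n, x, hx, (abs_lt.1 hn).1, (abs_lt.1 hn).2.le⟩
  have : Countable N := hcount.to_subtype
  have hUN : ⋃ j : N, I j = univ := by
    rw [← hU]
    refine (iUnion_subset fun j : N => subset_iUnion I (j : J)).antisymm ?_
    exact iUnion_subset fun j x hx => mem_iUnion.2 ⟨⟨j, ⟨x, hx⟩⟩, hx⟩
  rw [← tsum_subtype_eq_of_support_subset (s := N), ← setLIntegral_univ φ, ← hUN,
    lintegral_iUnion (s := fun j : N => I j) (fun j => hm j)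
      fun i j hij => hd (Subtype.coe_ne_coe.2 hij)]
  intro j hj
  by_contra hne
  rw [hN, mem_ofPred_eq, not_nonempty_iff_eq_empty] at hne
  simp [hne] at hj

/-! ### Bandpass generators -/

/-- The bandpass generator whose Fourier transform is `√c` on the interval `(p, q]` and zero
elsewhere. -/
noncomputable def bandpass (c p q : ℝ) : L2 :=
  (Lp.fourierTransformₗᵢ ℝ ℂ).symm
    (indicatorConstLp 2 (measurableSet_Ioc (a := p) (b := q)) (by simp) (Real.sqrt c : ℂ))

lemma fourier_bandpass (c p q : ℝ) : (𝓕 (bandpass c p q) : L2) =ᵐ[volume]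
    (Ioc p q).indicator fun _ => (Real.sqrt c : ℂ) := by
  have h : (𝓕 (bandpass c p q) : L2) = indicatorConstLp 2 measurableSet_Ioc (by simp) _ :=
    (Lp.fourierTransformₗᵢ ℝ ℂ).apply_symm_apply _
  rw [h]
  exact indicatorConstLp_coeFn

lemma enorm_sqrt_sq {c : ℝ} (hc : 0 ≤ c) : ‖(Real.sqrt c : ℂ)‖ₑ ^ 2 = ENNReal.ofReal c := by
  rw [← ofReal_norm, Complex.norm_real, ← ENNReal.ofReal_pow (norm_nonneg _), Real.norm_eq_abs,
    sq_abs, Real.sq_sqrt hc]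

/-- The energy function of a bandpass generator is constant when the band fits into one period of
the dual lattice. -/
lemma energy_bandpass {Γ : Submodule ℤ ℝ} {c : ℝ} (hc : 0 < c)
    (hΓ : ∀ x, x ∈ Γ ↔ ∃ k : ℤ, x = k * c) {p q : ℝ} (hpq : q ≤ p + c⁻¹) (f : L2) (x : ℝ) :
    energy Γ f (bandpass c p q) x = ∫⁻ ω in Ioc p q, ‖(𝓕 f : L2) ω‖ₑ ^ 2 := by
  have hb := fourier_bandpass c p q
  have hs : ∀ᵐ ω, ω ∉ Ioc p (p + c⁻¹) → crossSpectrum f (bandpass c p q) ω = 0 := by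
    filter_upwards [hb] with ω hω hm
    rw [crossSpectrum, hω, indicator_of_notMem fun h => hm (Ioc_subset_Ioc_right hpq h),
      inner_zero_left]
  have h2 : MemLp (crossSpectrum f (bandpass c p q)) 2 volume := by
    refine (Lp.memLp (𝓕 f : L2)).of_le_mul (c := Real.sqrt c)
      (measurable_crossSpectrum _ _).aestronglyMeasurable ?_
    filter_upwards [hb] with ω hω
    rw [crossSpectrum, hω]
    refine (norm_inner_le_norm _ _).trans (mul_le_mul_of_nonneg_right ?_ (norm_nonneg _))
    refine (norm_indicator_le_norm_self _ _).trans_eq ?_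
    rw [Complex.norm_real, Real.norm_of_nonneg (Real.sqrt_nonneg _)]
  have h := tsum_enorm_sq_fourier_of_indicator (inv_pos.2 hc) p h2 hs x
  rw [inv_inv] at h
  rw [energy_eq_tsum hc hΓ, h, ← lintegral_const_mul' _ _ ENNReal.ofReal_ne_top,
    ← lintegral_indicator measurableSet_Ioc]
  refine lintegral_congr_ae ?_
  filter_upwards [hb] with ω hω
  rw [enorm_crossSpectrum, hω]
  by_cases hm : ω ∈ Ioc p q
  · rw [indicator_of_mem hm, indicator_of_mem hm, mul_pow, enorm_sqrt_sq hc.le, mul_left_comm,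
      ← ENNReal.ofReal_mul (inv_pos.2 hc).le, inv_mul_cancel₀ hc.ne', ENNReal.ofReal_one, mul_one]
  · rw [indicator_of_notMem hm, indicator_of_notMem hm]
    simp

lemma hasSum_toReal_of_tsum_eq {ι : Type*} {a : ι → ℝ≥0∞} {s : ℝ} (hs : 0 ≤ s)
    (h : ∑' i, a i = ENNReal.ofReal s) : HasSum (fun i => (a i).toReal) s := by
  have hne : ∑' i, a i ≠ ⊤ := h ▸ ENNReal.ofReal_ne_top
  have h1 := ENNReal.hasSum_toReal hne
  rwa [← ENNReal.tsum_toReal_eq fun i => ENNReal.ne_top_of_tsum_ne_top hne i, h,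
    ENNReal.toReal_ofReal hs] at h1

lemma translate_zero (f : L2) : translate 0 f = f := by
  apply Lp.ext
  refine (translate_ae _ _).trans (.of_forall fun y => ?_)
  simp

lemma isFrameGenerators_of_energy {Γ : J → Submodule ℤ ℝ} {g : J → L2}
    (h : ∀ f : L2, ∑' j, energy (Γ j) f (g j) 0 = ENNReal.ofReal (‖f‖ ^ 2)) :
    IsFrameGenerators Γ g := by
  refine ⟨1, 1, one_pos, fun f => ?_⟩
  have h1 : HasSum (fun p => ‖inner ℂ (system Γ g p) f‖ ^ 2) (‖f‖ ^ 2) := by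
    have h2 : ∑' p, ‖inner ℂ (system Γ g p) f‖ₑ ^ 2 = ENNReal.ofReal (‖f‖ ^ 2) := by
      rw [← h f, ENNReal.tsum_sigma']
      simp only [energy, translate_zero]
      rfl
    simpa using hasSum_toReal_of_tsum_eq (by positivity) h2
  exact ⟨h1.summable, by rw [h1.tsum_eq, one_mul], by rw [h1.tsum_eq, one_mul]⟩

lemma hasMean_const (a : ℝ) : HasMean (fun _ => a) a := by
  refine tendsto_const_nhds.congr' ?_
  filter_upwards [eventually_gt_atTop 0] with n hn
  have hn0 : (n : ℝ) ≠ 0 := by exact_mod_cast hn.ne'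
  rw [intervalIntegral.integral_const, smul_eq_mul]
  field_simp
  ring

lemma isAlmostPeriodic_const (z : ℂ) : IsAlmostPeriodic (BoundedContinuousFunction.const ℝ z) := by
  have h : (fun x : ℝ => (BoundedContinuousFunction.const ℝ z).compContinuous
      ⟨fun y : ℝ => y - x, continuous_id.sub continuous_const⟩)
      = fun _ => BoundedContinuousFunction.const ℝ z := by
    funext x
    ext y
    rfl
  rw [IsAlmostPeriodic, h, range_const, closure_singleton]
  exact isCompact_singleton

/-- If all energy functions are constant and add up to `‖f‖²`, the `1`-UCP holds, since constants
are almost periodic and equal to their means. -/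
lemma oneUCP_of_energy_const {Γ : J → Submodule ℤ ℝ} {g : J → L2} (E : Set ℝ) {e : J → L2 → ℝ≥0∞}
    (he : ∀ j f x, energy (Γ j) f (g j) x = e j f)
    (hsum : ∀ f, ∑' j, e j f = ENNReal.ofReal (‖f‖ ^ 2)) : OneUCP E Γ g := by
  intro f _
  have h1 : HasSum (fun j => (e j f).toReal) (‖f‖ ^ 2) :=
    hasSum_toReal_of_tsum_eq (by positivity) (hsum f)
  refine ⟨BoundedContinuousFunction.const ℝ ((‖f‖ ^ 2 : ℝ) : ℂ), fun x => ?_,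
    isAlmostPeriodic_const _, fun ε hε => ?_⟩
  · simp only [wTerm_self, he, BoundedContinuousFunction.const_apply]
    exact Complex.hasSum_ofReal.2 h1
  · obtain ⟨S, hS⟩ := eventually_atTop.1 (Metric.tendsto_nhds.1 h1 ε hε)
    refine ⟨S, fun S' hS' => ⟨dist (∑ j ∈ S', (e j f).toReal) (‖f‖ ^ 2), hS S' hS', ?_⟩⟩
    simp only [wTerm_self, he, BoundedContinuousFunction.const_apply]
    convert hasMean_const _ using 2
    rw [dist_comm, Real.dist_eq, ← Complex.ofReal_sum, ← Complex.ofReal_sub, Complex.norm_real,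
      Real.norm_eq_abs]

/-- A test function is bounded with support in a bounded interval. -/
lemma exists_bound_of_mem_testSpace {E : Set ℝ} {f : L2} (hf : f ∈ testSpace E) :
    ∃ (C : ℝ≥0∞) (r : ℝ), C ≠ ⊤ ∧ 0 ≤ r ∧ (∀ᵐ ω, ‖(𝓕 f : L2) ω‖ₑ ≤ C) ∧
      ∀ᵐ ω, ω ∉ Ioc (-r) r → (𝓕 f : L2) ω = 0 := by
  obtain ⟨hbd, K, hK, -, hKf⟩ := hf
  obtain ⟨r, hr⟩ := hK.isBounded.subset_ball 0
  refine ⟨eLpNorm (𝓕 f : L2) ∞ volume, |r|, hbd.2.ne, abs_nonneg _, ?_, ?_⟩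
  · rw [eLpNorm_exponent_top]
    exact enorm_ae_le_eLpNormEssSup _ _
  · filter_upwards [hKf] with ω hω hm
    rw [← hω, indicator_of_notMem]
    intro hωK
    have h1 := hr hωK
    rw [mem_ball_zero_iff, Real.norm_eq_abs, abs_lt] at h1
    have h2 := le_abs_self r
    exact hm ⟨by linarith, by linarith⟩

/-- For bandpass generators with locally finite bands, only finitely many lattices, and for each of
them only finitely many dual lattice points, contribute to the local integrability condition. -/
lemma lic_bandpass {Γ : J → Submodule ℤ ℝ} (E : Set ℝ) {c p q : J → ℝ} (hc : ∀ j, 0 < c j)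
    (hΓ : ∀ j x, x ∈ Γ j ↔ ∃ k : ℤ, x = k * c j)
    (hfin : ∀ r : ℝ, {j | (Ioc (p j) (q j) ∩ Ioc (-r) r).Nonempty}.Finite) :
    LIC E Γ fun j => bandpass (c j) (p j) (q j) := by
  intro f hf
  obtain ⟨C, r, hC, hr0, hbd, hsupp⟩ := exists_bound_of_mem_testSpace hf
  set a := (𝓕 f : L2) with ha
  have hshift : ∀ (P : ℝ → Prop) (α : ℝ), (∀ᵐ ω, P ω) → ∀ᵐ ω, P (ω + α) := fun P α h =>
    (measurePreserving_add_right (volume : Measure ℝ) α).quasiMeasurePreserving.ae h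
  rw [tsum_eq_sum (s := (hfin r).toFinset)]
  · refine ENNReal.sum_lt_top.2 fun j _ => ?_
    rw [ENNReal.tsum_mul_left]
    refine ENNReal.mul_lt_top ENNReal.ofReal_lt_top ?_
    rw [← (intMulEquiv (inv_pos.2 (hc j)).ne' (mem_annihilator_iff (hc j) (hΓ j))).tsum_eq]
    simp only [coe_intMulEquiv]
    set b := (𝓕 (bandpass (c j) (p j) (q j)) : L2)
    rw [tsum_eq_sum (s := Finset.Icc (-⌈2 * r * c j⌉) ⌈2 * r * c j⌉)]
    · refine ENNReal.sum_lt_top.2 fun k _ => ?_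
      calc _ ≤ ∫⁻ ω : ℝ, C * C * ‖b ω‖ₑ ^ 2 := by
            refine lintegral_mono_ae ?_
            filter_upwards [hbd, hshift _ (k * (c j)⁻¹) hbd] with ω h1 h2
            rw [enorm_mul]
            gcongr
        _ < ⊤ := by
            rw [lintegral_const_mul' _ _ (ENNReal.mul_ne_top hC hC), lintegral_enorm_sq_eq]
            exact ENNReal.mul_lt_top (ENNReal.mul_lt_top hC.lt_top hC.lt_top)
              ENNReal.ofReal_lt_top
    · intro k hk
      rw [← lintegral_zero (μ := (volume : Measure ℝ))]
      refine lintegral_congr_ae ?_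
      filter_upwards [hsupp, hshift _ (k * (c j)⁻¹) hsupp] with ω h1 h2
      by_cases hm : ω ∈ Ioc (-r) r
      · -- two points of `(-r, r]` differ by less than `2 * r`
        rw [h2, mul_zero, enorm_zero, zero_mul]
        intro hm2
        have habs : |(k : ℝ)| ≤ 2 * r * c j := by
          have h3 : |(k : ℝ) * (c j)⁻¹| ≤ 2 * r := by
            rw [abs_le]; constructor <;> linarith [hm.1, hm.2, hm2.1, hm2.2]
          rwa [abs_mul, abs_of_pos (inv_pos.2 (hc j)), mul_inv_le_iff₀ (hc j)] at h3
        refine hk (Finset.mem_Icc.2 ?_)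
        have h4 := habs.trans (Int.le_ceil _)
        rw [abs_le] at h4
        exact ⟨by exact_mod_cast h4.1, by exact_mod_cast h4.2⟩
      · rw [h1 hm, zero_mul, enorm_zero, zero_mul]
  · intro j hj
    rw [ENNReal.tsum_eq_zero]
    intro α
    refine mul_eq_zero_of_right _ ?_
    rw [← lintegral_zero (μ := (volume : Measure ℝ))]
    refine lintegral_congr_ae ?_
    filter_upwards [hsupp, fourier_bandpass (c j) (p j) (q j)] with ω h1 h2
    by_cases hm : ω ∈ Ioc (-r) r
    · rw [h2, indicator_of_notMem]
      · simp
      · intro hm2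
        exact hj ((hfin r).mem_toFinset.2 ⟨ω, hm2, hm⟩)
    · rw [h1 hm, zero_mul, enorm_zero, zero_mul]

lemma exists_generators_of_bandwidth_eq_top (Γ : J → Submodule ℤ ℝ)
    [∀ j, DiscreteTopology (Γ j)] [∀ j, IsZLattice ℝ (Γ j)] (E : Set ℝ) (h : bandwidth Γ = ⊤) :
    ∃ g : J → L2, IsFrameGenerators Γ g ∧ LIC E Γ g ∧ OneUCP E Γ g := by
  choose c hc hcov hΓ using fun j => exists_generator (Γ j)
  simp only [bandwidth, hcov, one_div] at h
  obtain ⟨p, q, hpq, hd, hU, hfin⟩ := exists_tiling_real (fun j => (inv_pos.2 (hc j)).le) h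
  have he : ∀ j f x, energy (Γ j) f (bandpass (c j) (p j) (q j)) x
      = ∫⁻ ω in Ioc (p j) (q j), ‖(𝓕 f : L2) ω‖ₑ ^ 2 := fun j f x =>
    energy_bandpass (hc j) (hΓ j) (hpq j) f x
  have hsum : ∀ f : L2, ∑' j, ∫⁻ ω in Ioc (p j) (q j), ‖(𝓕 f : L2) ω‖ₑ ^ 2
      = ENNReal.ofReal (‖f‖ ^ 2) := fun f => by
    rw [tsum_setLIntegral_of_locallyFinite (fun _ => measurableSet_Ioc) hd hU hfin,
      lintegral_enorm_sq_eq, Lp.norm_fourier_eq]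
  exact ⟨_, isFrameGenerators_of_energy fun f => by simp only [he, hsum], lic_bandpass E hc hΓ hfin,
    oneUCP_of_energy_const E he hsum⟩

end GSI

theorem corollary3p19 {J : Type*} (Γ : J → Submodule ℤ ℝ)
    [∀ j, DiscreteTopology (Γ j)] [∀ j, IsZLattice ℝ (Γ j)]
    (E : Set ℝ) (hE : IsClosed E) (hE0 : MeasureTheory.volume E = 0) :
    [∃ g : J → GSI.L2, GSI.IsFrameGenerators Γ g ∧ GSI.LIC E Γ g,
      ∃ g : J → GSI.L2, GSI.IsFrameGenerators Γ g ∧ GSI.AlphaLIC E Γ g,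
      ∃ g : J → GSI.L2, GSI.IsFrameGenerators Γ g ∧ GSI.OneUCP E Γ g,
      GSI.bandwidth Γ = ⊤].TFAE := by
  tfae_have 1 → 2 := fun ⟨g, hg, h⟩ => ⟨g, hg, h.alphaLIC⟩
  tfae_have 2 → 4 := fun ⟨_, hg, h⟩ => h.bandwidth_eq_top hE hE0 hg
  tfae_have 3 → 4 := fun ⟨_, hg, h⟩ => h.bandwidth_eq_top hE hE0 hg
  tfae_have 4 → 1 := fun h =>
    let ⟨g, hg, h1, _⟩ := GSI.exists_generators_of_bandwidth_eq_top Γ E h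
    ⟨g, hg, h1⟩
  tfae_have 4 → 3 := fun h =>
    let ⟨g, hg, _, h3⟩ := GSI.exists_generators_of_bandwidth_eq_top Γ E h
    ⟨g, hg, h3⟩
  tfae_finish
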